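/- Theorem (Hölder estimates). Let $n\in\mathbb{N}$, $0<\sigma<1$ and $\alpha\in(0,1]$, and let $\mathbb{T}^n=\mathbb{R}^n/(2\pi\mathbb{Z}^n)$. For smooth $\phi$ on $\mathbb{T}^n$ let $(-\Delta_{\mathbb{T}^n})^\sigma\phi(z)=\sum_{k\in\mathbb{Z}^n}|k|^{2\sigma}c_k(\phi)e^{ik\cdot z}$, where $c_k(\phi)=(2\pi)^{-n}\int_{\mathbb{T}^n}\phi(z)e^{-ik\cdot z}\,dz$, and for a continuous function $v:\mathbb{T}^n\to\mathbb{R}$ let $(-\Delta_{\mathbb{T}^n})^\sigma v$ be the periodic distribution $\phi\mapsto\int_{\mathbb{T}^n}v\,(-\Delta_{\mathbb{T}^n})^\sigma\phi\,dz$, $\phi\in C^\infty(\mathbb{T}^n)$. For an integer $k\ge 0$ and $0<\alpha\le 1$, $C^{k,\alpha}(\mathbb{T}^n)$ is the space of real functions $v\in C^k(\mathbb{T}^n)$ such that $$[D^\gamma v]_{C^\alpha}=\sup_{x\ne y}\frac{|D^\gamma v(x)-D^\gamma v(y)|}{d(x,y)^\alpha}<\infty\quad\text{for all multi-indices } |\gamma|=k,$$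 where $d$ is the geodesic distance on $\mathbb{T}^n$, with norm $\|v\|_{C^{k,\alpha}}=\sum_{|\gamma|\le k}\sup|D^\gamma v|+\sum_{|\gamma|=k}[D^\gamma v]_{C^\alpha}$. In each of the following cases the distribution $(-\Delta_{\mathbb{T}^n})^\sigma v$ is given by a function in the space named, and the estimate holds with a constant $C$ that does not depend on $v$ (it depends only on $n$, $\sigma$, $\alpha$ and, in (4), $k$). 1. If $v\in C^{0,\alpha}(\mathbb{T}^n)$ and $2\sigma<\alpha$, then $(-\Delta_{\mathbb{T}^n})^\sigma v\in C^{0,\alpha-2\sigma}(\mathbb{T}^n)$ and $\|(-\Delta_{\mathbb{T}^n})^\sigma v\|_{C^{0,\alpha-2\sigma}}\le C\|v\|_{C^{0,\alpha}}$. 2. If $v\in C^{1,\alpha}(\mathbb{T}^n)$ and $2\sigma<\alpha$, then $(-\Delta_{\mathbb{T}^n})^\sigma v\in C^{1,\alpha-2\sigma}(\mathbb{T}^n)$ and $\|(-\Delta_{\mathbb{T}^n})^\sigma v\|_{C^{1,\alpha-2\sigma}}\le C\|v\|_{C^{1,\alpha}}$. 3. If $v\in C^{1,\alpha}(\mathbb{T}^n)$,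 $2\sigma>\alpha$ and $\alpha-2\sigma+1>0$, then $(-\Delta_{\mathbb{T}^n})^\sigma v\in C^{0,\alpha-2\sigma+1}(\mathbb{T}^n)$ and $\|(-\Delta_{\mathbb{T}^n})^\sigma v\|_{C^{0,\alpha-2\sigma+1}}\le C\|v\|_{C^{1,\alpha}}$. 4. If $v\in C^{k,\alpha}(\mathbb{T}^n)$ with an integer $k\ge0$, and $k+\alpha-2\sigma$ is positive and not an integer, then $(-\Delta_{\mathbb{T}^n})^\sigma v\in C^{l,\beta}(\mathbb{T}^n)$, where $l$ is the integer part of $k+\alpha-2\sigma$ and $\beta=k+\alpha-2\sigma-l$, and $\|(-\Delta_{\mathbb{T}^n})^\sigma v\|_{C^{l,\beta}}\le C\|v\|_{C^{k,\alpha}}$. -/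

import Mathlib

open scoped ENNReal NNReal

noncomputable section

namespace FracTorus

/-- The torus `𝕋ⁿ = ℝⁿ / (2πℤ)ⁿ`, as the product of `n` circles of length `2π`.  Its `volume` is the
product measure, that is, Lebesgue measure on `(-π, π]ⁿ` (total mass `(2π)ⁿ`). -/
abbrev Torus (n : ℕ) : Type := Fin n → AddCircle (2 * Real.pi)

instance circleLength_pos : Fact (0 < 2 * Real.pi) := ⟨Real.two_pi_pos⟩

variable {n : ℕ}

/-- The periodic function on `ℝⁿ` given by a function on the torus. -/
def repetition {E : Type*} (v : Torus n → E) : (Fin n → ℝ) → E :=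
  fun x => v (fun i => (x i : AddCircle (2 * Real.pi)))

/-- `v ∈ C^m(𝕋ⁿ)`, for `m ∈ ℕ` or `m = ∞`. -/
def IsCm {E : Type*} [NormedAddCommGroup E] [NormedSpace ℝ E] (m : ℕ∞) (v : Torus n → E) : Prop :=
  ContDiff ℝ m (repetition v)

/-- The character `z ↦ e^{i k·z}` of the torus, for `k ∈ ℤⁿ`. -/
def character (k : Fin n → ℤ) (z : Torus n) : ℂ := ∏ i, fourier (k i) (z i)

/-- The Fourier coefficient `c_k(φ) = (2π)⁻ⁿ ∫ φ(z) e^{-i k·z} dz`. -/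
def fourierCoefficient (φ : Torus n → ℂ) (k : Fin n → ℤ) : ℂ :=
  ((2 * Real.pi : ℂ) ^ n)⁻¹ * ∫ z : Torus n, φ z * character (-k) z

/-- The Euclidean length of `k ∈ ℤⁿ`. -/
def length (k : Fin n → ℤ) : ℝ := √(∑ i, (k i : ℝ) ^ 2)

/-- The fractional Laplacian of a smooth function on the torus, by its multiple Fourier series
`∑ |k|^{2σ} c_k(φ) e^{i k·z}` (absolutely convergent for smooth `φ`). -/
def fracLaplacian (σ : ℝ) (φ : Torus n → ℂ) (z : Torus n) : ℂ :=
  ∑' k : Fin n → ℤ, ((length k ^ (2 * σ) : ℝ) : ℂ) * fourierCoefficient φ k * character k z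

/-- The fractional Laplacian of a function `v` as a periodic distribution, evaluated at a smooth
function `φ`: `⟨(-Δ)^σ v, φ⟩ = ∫ v (-Δ)^σ φ dz`. -/
def fracLaplacianDistribution (σ : ℝ) (v : Torus n → ℝ) (φ : Torus n → ℂ) : ℂ :=
  ∫ z : Torus n, (v z : ℂ) * fracLaplacian σ φ z

/-- The periodic distribution `(-Δ)^σ v` is (given by integration against) the function `w`. -/
def IsFracLaplacian (σ : ℝ) (v w : Torus n → ℝ) : Prop :=
  ∀ φ : Torus n → ℂ, IsCm ⊤ φ →
    fracLaplacianDistribution σ v φ = ∫ z : Torus n, (w z : ℂ) * φ z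

/-- The geodesic distance of the flat torus; `‖x i - y i‖` is the arc length distance between the
`i`-th coordinates on the circle of length `2π`. -/
def geodesicDist (x y : Torus n) : ℝ := √(∑ i, ‖x i - y i‖ ^ 2)

/-- The partial derivative `∂ᵢ v` on the torus. -/
def partialDeriv (i : Fin n) (v : Torus n → ℝ) : Torus n → ℝ :=
  fun z => deriv (fun t : ℝ => v (z + Pi.single i (t : AddCircle (2 * Real.pi)))) 0

/-- The derivative `D^γ v = ∂₁^{γ₁} ⋯ ∂ₙ^{γₙ} v`, for a multi-index `γ`. -/
def multiDeriv (γ : Fin n → ℕ) (v : Torus n → ℝ) : Torus n → ℝ :=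
  (List.finRange n).foldr (fun i f => (partialDeriv i)^[γ i] f) v

/-- The sup norm, with values in `[0, ∞]`. -/
def supNorm (f : Torus n → ℝ) : ℝ≥0∞ := ⨆ x, ENNReal.ofReal |f x|

/-- The Hölder seminorm `[f]_{C^α}`, with values in `[0, ∞]`. -/
def holderSeminorm (α : ℝ) (f : Torus n → ℝ) : ℝ≥0∞ :=
  ⨆ (x : Torus n) (y : Torus n) (_ : x ≠ y), ENNReal.ofReal (|f x - f y| / geodesicDist x y ^ α)

/-- `v ∈ C^{k,α}(𝕋ⁿ)`. -/
def MemHolderSpace (k : ℕ) (α : ℝ) (v : Torus n → ℝ) : Prop :=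
  IsCm k v ∧ ∀ γ : Fin n → ℕ, ∑ i, γ i = k → holderSeminorm α (multiDeriv γ v) ≠ ⊤

/-- The norm of `C^{k,α}(𝕋ⁿ)`: `∑_{|γ| ≤ k} sup |D^γ v| + ∑_{|γ| = k} [D^γ v]_{C^α}`.
(`Finset.piAntidiag Finset.univ j` is the set of multi-indices of order `j`.) -/
def holderNorm (k : ℕ) (α : ℝ) (v : Torus n → ℝ) : ℝ≥0∞ :=
  (∑ j ∈ Finset.range (k + 1), ∑ γ ∈ Finset.piAntidiag (Finset.univ : Finset (Fin n)) j,
      supNorm (multiDeriv γ v)) +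
    ∑ γ ∈ Finset.piAntidiag (Finset.univ : Finset (Fin n)) k, holderSeminorm α (multiDeriv γ v)

/-- `(-Δ)^σ` maps `C^{k,α}(𝕋ⁿ)` to `C^{l,β}(𝕋ⁿ)` with a norm bound: there is a constant `C` such that
for all `v ∈ C^{k,α}(𝕋ⁿ)` the distribution `(-Δ)^σ v` is a function in `C^{l,β}(𝕋ⁿ)` with norm at
most `C` times that of `v`. -/
def FracLaplacianBounded (n : ℕ) (σ : ℝ) (k : ℕ) (α : ℝ) (l : ℕ) (β : ℝ) : Prop :=
  ∃ C : ℝ≥0, ∀ v : Torus n → ℝ, MemHolderSpace k α v →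
    ∃ w : Torus n → ℝ, IsFracLaplacian σ v w ∧ MemHolderSpace l β w ∧
      holderNorm l β w ≤ C * holderNorm k α v

end FracTorus

end

/-! Put `s = 2σ`. The operator is, up to a nonzero constant, the singular integral over `ℝⁿ` of
`|y|^{-n-s} (2v(x) - v(x+y) - v(x-y))`, taken of the periodic lift of `v`; the Hölder estimate is
then an estimate for this integral.

Identification. The Fourier symbol of the integral is rotation invariant, homogeneous of degree `s`
and positive off zero, so it equals `κ|ξ|^s` with `κ ≠ 0` (`exists_lapSymbol_eq`). Fourier inversion
gives `fracLaplacian σ φ = κ⁻¹ torusLap (2σ) φ` for smooth `φ` (`fracLaplacian_eq`). The integral is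
a symmetric operator by Fubini and translation invariance (`integral_mul_torusLap`), so the
distribution of `v` is the function `κ⁻¹ torusLap (2σ) v`.

Estimate. Write `k = j + l` with `0 < j + α - s < 1`, which forces `j ≤ 2`. The integral commutes
with derivatives, so `l` of them pass through it (`hasFDerivAt_lap`) and only `l = 0` needs work.
There, with `p = j + α` and `d = |x₁ - x₂|`, the second differences at `x₁` and `x₂` differ by at
most a multiple of `min(|y|^a d^{p-a}, |y|^b d^{p-b})` for some `b < s < a`. The first bound makes
the integral converge at zero and the second at infinity, and rescaling `y` by `d` gives `d^{p-s}`
(`norm_lap_sub_le`). The induction on `l` replaces `f` by its Fréchet derivative, so all of this is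
proved for Banach-valued functions with constants that do not depend on the target space. -/

open MeasureTheory Set Filter Topology Module
open scoped ENNReal NNReal

set_option linter.unusedSectionVars false

namespace FracTorus

universe u

/-! ### The Riesz kernel -/

section Kernel

variable {E : Type u} [NormedAddCommGroup E] [InnerProductSpace ℝ E]

/-- The kernel `|y|^{-d-s}` of the fractional Laplacian of order `s` in dimension `d`. -/
noncomputable def rieszKernel (s : ℝ) (y : E) : ℝ := ‖y‖ ^ (-(finrank ℝ E : ℝ) - s)

lemma rieszKernel_nonneg (s : ℝ) (y : E) : 0 ≤ rieszKernel s y := by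
  unfold rieszKernel; positivity

/-- As `b < a`, the minimum is `r^a` up to `1` and `r^b` beyond, so each end has its own convergent
power. -/
lemma integrableOn_min_rpow {a b s : ℝ} (hb : b < s) (ha : s < a) :
    IntegrableOn (fun r : ℝ => min (r ^ a) (r ^ b) * r ^ (-1 - s)) (Ioi 0) := by
  rw [← Ioc_union_Ioi_eq_Ioi zero_le_one, integrableOn_union]
  constructor
  · have h : IntegrableOn (fun r : ℝ => r ^ (a - 1 - s)) (Ioc 0 1) :=
      (intervalIntegrable_iff_integrableOn_Ioc_of_le zero_le_one).1
        (intervalIntegral.intervalIntegrable_rpow' (by linarith))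
    refine h.congr_fun (fun r hr => ?_) measurableSet_Ioc
    have : r ^ a ≤ r ^ b := Real.rpow_le_rpow_of_exponent_ge hr.1 hr.2 (by linarith)
    simp only [min_eq_left this]
    rw [← Real.rpow_add hr.1]; congr 1; ring
  · have h : IntegrableOn (fun r : ℝ => r ^ (b - 1 - s)) (Ioi 1) :=
      integrableOn_Ioi_rpow_of_lt (by linarith) zero_lt_one
    refine h.congr_fun (fun r (hr : 1 < r) => ?_) measurableSet_Ioi
    have : r ^ b ≤ r ^ a := Real.rpow_le_rpow_of_exponent_le hr.le (by linarith)
    simp only [min_eq_right this]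
    rw [← Real.rpow_add (by linarith)]; congr 1; ring

variable [FiniteDimensional ℝ E] [MeasurableSpace E] [BorelSpace E]

lemma measurable_rieszKernel (s : ℝ) : Measurable (rieszKernel s : E → ℝ) := by
  unfold rieszKernel; fun_prop

lemma integrable_min_mul_rieszKernel {a b s : ℝ} (hb : b < s) (ha : s < a) :
    Integrable (fun y : E => min (‖y‖ ^ a) (‖y‖ ^ b) * rieszKernel s y) := by
  -- Polar coordinates need positive dimension; in dimension zero the integrand is constant and the
  -- measure finite.
  rcases subsingleton_or_nontrivial E with h | h
  · have : (fun y : E => min (‖y‖ ^ a) (‖y‖ ^ b) * rieszKernel s y)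
        = fun _ => min (‖(0 : E)‖ ^ a) (‖(0 : E)‖ ^ b) * rieszKernel s (0 : E) := by
      ext y; rw [Subsingleton.elim y 0]
    rw [this]
    exact integrable_const _
  · have key := (integrable_fun_norm_addHaar (E := E) (volume : Measure E)
      (f := fun r : ℝ => min (r ^ a) (r ^ b) * r ^ (-(finrank ℝ E : ℝ) - s))).2 ?_
    · exact key
    · refine (integrableOn_min_rpow hb ha).congr_fun (fun r (hr : 0 < r) => ?_) measurableSet_Ioi
      have hd : 0 < finrank ℝ E := finrank_pos
      simp only [smul_eq_mul]
      rw [← Real.rpow_natCast, Nat.cast_sub hd, mul_left_comm, ← Real.rpow_add hr]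
      congr 2; push_cast; ring

lemma integrable_min_one_mul_rieszKernel {a s : ℝ} (hs : 0 < s) (ha : s < a) :
    Integrable (fun y : E => min (‖y‖ ^ a) 1 * rieszKernel s y) := by
  simpa using integrable_min_mul_rieszKernel (E := E) hs ha

lemma integral_smul_rieszKernel {d : ℝ} (hd : 0 < d) (s : ℝ) (f : E → ℝ) :
    ∫ y : E, f (d⁻¹ • y) * rieszKernel s y = d ^ (-s) * ∫ y : E, f y * rieszKernel s y := by
  have h := Measure.integral_comp_smul (volume : Measure E)
    (fun y : E => f y * rieszKernel s y) d⁻¹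
  have h2 : ∀ y : E, rieszKernel s (d⁻¹ • y) = d ^ ((finrank ℝ E : ℝ) + s) * rieszKernel s y := by
    intro y
    unfold rieszKernel
    rw [norm_smul, Real.norm_of_nonneg (by positivity), Real.mul_rpow (by positivity)
      (norm_nonneg _), Real.inv_rpow hd.le, ← Real.rpow_neg hd.le]
    congr 2; ring
  simp only [h2] at h
  have h3 : ∀ y : E, f (d⁻¹ • y) * (d ^ ((finrank ℝ E : ℝ) + s) * rieszKernel s y)
      = d ^ ((finrank ℝ E : ℝ) + s) * (f (d⁻¹ • y) * rieszKernel s y) := fun y => by ring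
  simp only [h3] at h
  rw [integral_const_mul] at h
  have hp : 0 < d ^ ((finrank ℝ E : ℝ) + s) := by positivity
  rw [← mul_right_inj' hp.ne', h, ← mul_assoc, ← Real.rpow_add hd, smul_eq_mul,
    inv_pow, inv_inv, abs_of_nonneg (by positivity)]
  congr 1
  rw [← Real.rpow_natCast]; congr 1; ring

/-- Both branches are `d^p` times a function of `y / d`, and the kernel measure scales by `d^{-s}`.
This is the source of the Hölder exponent `p - s`. -/
lemma integral_min_rpow_mul_rieszKernel {d : ℝ} (hd : 0 < d) (a b s p : ℝ) :
    ∫ y : E, min (‖y‖ ^ a * d ^ (p - a)) (‖y‖ ^ b * d ^ (p - b)) * rieszKernel s y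
      = (∫ y : E, min (‖y‖ ^ a) (‖y‖ ^ b) * rieszKernel s y) * d ^ (p - s) := by
  have h := integral_smul_rieszKernel (E := E) hd s (fun y => min (‖y‖ ^ a) (‖y‖ ^ b))
  have h1 : ∀ (c : ℝ) (y : E), ‖y‖ ^ c * d ^ (p - c) = d ^ p * ‖d⁻¹ • y‖ ^ c := by
    intro c y
    rw [norm_smul, Real.norm_of_nonneg (by positivity), Real.mul_rpow (by positivity)
      (norm_nonneg _), Real.inv_rpow hd.le, Real.rpow_sub hd]
    field_simp
  simp only [h1, ← mul_min_of_nonneg _ _ (Real.rpow_nonneg hd.le p), mul_assoc]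
  rw [integral_const_mul, h, sub_eq_add_neg, Real.rpow_add hd]
  ring

end Kernel

/-! ### Second differences and the singular integral -/

section Lap

variable {E : Type u} [NormedAddCommGroup E] [InnerProductSpace ℝ E]
  {F : Type u} [NormedAddCommGroup F] [NormedSpace ℝ F]

/-- The symmetric second difference `2 f(x) - f(x + y) - f(x - y)`. -/
def secondDiff (y : E) (f : E → F) (x : E) : F := f x + f x - f (x + y) - f (x - y)

/-- The singular integral `∫ |y|^{-d-s} (2 f(x) - f(x + y) - f(x - y)) dy`, a multiple of the
fractional Laplacian of order `s`. -/
noncomputable def lap [MeasurableSpace E] [FiniteDimensional ℝ E] [BorelSpace E]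
    (s : ℝ) (f : E → F) (x : E) : F :=
  ∫ y : E, rieszKernel s y • secondDiff y f x

/-- Second differences are bounded by `A min(|y|^a, 1)`. -/
def SecondDiffBound (a A : ℝ) (f : E → F) : Prop :=
  ∀ x y, ‖secondDiff y f x‖ ≤ A * min (‖y‖ ^ a) 1

lemma secondDiffBound_of_le {a M K : ℝ} {f : E → F} (hM : ∀ x, ‖f x‖ ≤ M)
    (hK : ∀ x y, ‖secondDiff y f x‖ ≤ K * ‖y‖ ^ a) : SecondDiffBound a (4 * M + K) f := by
  intro x y
  have hM0 : 0 ≤ M := (norm_nonneg _).trans (hM 0)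
  have hK0 : 0 ≤ K * ‖y‖ ^ a := (norm_nonneg _).trans (hK x y)
  have h1 : ‖secondDiff y f x‖ ≤ 4 * M := by
    unfold secondDiff
    have h1 := norm_sub_le (f x + f x - f (x + y)) (f (x - y))
    have h2 := norm_sub_le (f x + f x) (f (x + y))
    have h3 := norm_add_le (f x) (f x)
    linarith [hM x, hM (x + y), hM (x - y)]
  have hp : 0 ≤ ‖y‖ ^ a := by positivity
  rcases le_total (‖y‖ ^ a) 1 with h | h
  · rw [min_eq_left h]
    nlinarith [hK x y]
  · rw [min_eq_right h]
    -- A negative `K` contradicts `hK0`, because here `‖y‖ ^ a ≥ 1`.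
    rcases le_or_gt 0 K with h0 | h0
    · linarith
    · nlinarith

lemma hasFDerivAt_secondDiff {f : E → F} (hf : Differentiable ℝ f) (y x : E) :
    HasFDerivAt (secondDiff y f) (secondDiff y (fderiv ℝ f) x) x := by
  unfold secondDiff
  have h1 : HasFDerivAt (fun x => f (x + y)) (fderiv ℝ f (x + y)) x := by
    simpa [Function.comp_def] using (hf (x + y)).hasFDerivAt.comp x ((hasFDerivAt_id x).add_const y)
  have h2 : HasFDerivAt (fun x => f (x - y)) (fderiv ℝ f (x - y)) x := by
    simpa [Function.comp_def] using (hf (x - y)).hasFDerivAt.comp x ((hasFDerivAt_id x).sub_const y)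
  exact (((hf x).hasFDerivAt.add (hf x).hasFDerivAt).sub h1).sub h2

variable [FiniteDimensional ℝ E] [MeasurableSpace E] [BorelSpace E]

lemma aestronglyMeasurable_lap_integrand (s : ℝ) {f : E → F} (hf : Continuous f) (x : E) :
    AEStronglyMeasurable (fun y : E => rieszKernel s y • secondDiff y f x) := by
  refine (measurable_rieszKernel s).aestronglyMeasurable.smul ?_
  refine Continuous.aestronglyMeasurable ?_
  unfold secondDiff
  fun_prop

lemma norm_lap_integrand_le {s a A : ℝ} {f : E → F} (hfA : SecondDiffBound a A f) (x y : E) :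
    ‖rieszKernel s y • secondDiff y f x‖ ≤ A * (min (‖y‖ ^ a) 1 * rieszKernel s y) := by
  rw [norm_smul, Real.norm_of_nonneg (rieszKernel_nonneg s y)]
  nlinarith [hfA x y, rieszKernel_nonneg s y]

lemma integrable_lap_integrand {s a A : ℝ} (hs : 0 < s) (ha : s < a) {f : E → F}
    (hf : Continuous f) (hfA : SecondDiffBound a A f) (x : E) :
    Integrable (fun y : E => rieszKernel s y • secondDiff y f x) :=
  ((integrable_min_one_mul_rieszKernel hs ha).const_mul A).mono'
    (aestronglyMeasurable_lap_integrand s hf x)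
    (Eventually.of_forall fun y => norm_lap_integrand_le hfA x y)

lemma norm_lap_le {s a A : ℝ} (hs : 0 < s) (ha : s < a) {f : E → F}
    (hfA : SecondDiffBound a A f) (x : E) :
    ‖lap s f x‖ ≤ A * ∫ y : E, min (‖y‖ ^ a) 1 * rieszKernel s y := by
  rw [← integral_const_mul]
  exact norm_integral_le_of_norm_le ((integrable_min_one_mul_rieszKernel hs ha).const_mul A)
    (Eventually.of_forall fun y => norm_lap_integrand_le hfA x y)

lemma norm_lap_sub_le {s a b p A B : ℝ} (hs : 0 < s) (hb : b < s) (ha : s < a) {f : E → F}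
    (hf : Continuous f) (hfA : SecondDiffBound a A f) {x₁ x₂ : E} (hx : x₁ ≠ x₂)
    (h : ∀ y, ‖secondDiff y f x₁ - secondDiff y f x₂‖
      ≤ B * min (‖y‖ ^ a * ‖x₁ - x₂‖ ^ (p - a)) (‖y‖ ^ b * ‖x₁ - x₂‖ ^ (p - b))) :
    ‖lap s f x₁ - lap s f x₂‖
      ≤ B * (∫ y : E, min (‖y‖ ^ a) (‖y‖ ^ b) * rieszKernel s y) * ‖x₁ - x₂‖ ^ (p - s) := by
  have hd : 0 < ‖x₁ - x₂‖ := norm_pos_iff.2 (sub_ne_zero.2 hx)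
  unfold lap
  rw [← integral_sub (integrable_lap_integrand hs ha hf hfA x₁)
    (integrable_lap_integrand hs ha hf hfA x₂), mul_assoc,
    ← integral_min_rpow_mul_rieszKernel hd a b s p, ← integral_const_mul]
  set d := ‖x₁ - x₂‖
  refine norm_integral_le_of_norm_le (Integrable.const_mul ?_ B) (Eventually.of_forall fun y => ?_)
  -- Only integrability matters here, so both powers of `d` are replaced by their sum, which factors
  -- out of the minimum.
  · refine ((integrable_min_mul_rieszKernel (E := E) hb ha).const_mul
      (d ^ (p - a) + d ^ (p - b))).mono' ?_ (Eventually.of_forall fun y => ?_)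
    · refine (Measurable.mul ?_ (measurable_rieszKernel s)).aestronglyMeasurable
      fun_prop
    · have hK := rieszKernel_nonneg s y
      rw [Real.norm_of_nonneg (by positivity), ← mul_assoc]
      refine mul_le_mul_of_nonneg_right ?_ hK
      rw [mul_min_of_nonneg _ _ (by positivity)]
      refine min_le_min ?_ ?_
      · have : 0 ≤ ‖y‖ ^ a * d ^ (p - b) := by positivity
        nlinarith
      · have : 0 ≤ ‖y‖ ^ b * d ^ (p - a) := by positivity
        nlinarith
  · simp only [← smul_sub]
    rw [norm_smul, Real.norm_of_nonneg (rieszKernel_nonneg s y)]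
    nlinarith [h y, rieszKernel_nonneg s y]

/-- Second differences commute with `fderiv`, and the bound `A'` on those of the derivative is
uniform in `x`, hence dominates the differentiated integrand. -/
lemma hasFDerivAt_lap {s a A A' : ℝ} (hs : 0 < s) (ha : s < a) {f : E → F}
    (hf : Differentiable ℝ f) (hf' : Continuous (fderiv ℝ f)) (hfA : SecondDiffBound a A f)
    (hfA' : SecondDiffBound a A' (fderiv ℝ f)) (x : E) :
    HasFDerivAt (lap s f) (lap s (fderiv ℝ f) x) x := by
  unfold lap
  refine hasFDerivAt_integral_of_dominated_of_fderiv_le (s := univ) univ_mem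
    (bound := fun y => A' * (min (‖y‖ ^ a) 1 * rieszKernel s y))
    (F' := fun x y => rieszKernel s y • secondDiff y (fderiv ℝ f) x)
    (Eventually.of_forall fun x => aestronglyMeasurable_lap_integrand s hf.continuous x)
    (integrable_lap_integrand hs ha hf.continuous hfA x)
    (aestronglyMeasurable_lap_integrand s hf' x)
    (Eventually.of_forall fun y x _ => norm_lap_integrand_le hfA' x y)
    ((integrable_min_one_mul_rieszKernel hs ha).const_mul A')
    (Eventually.of_forall fun y x _ => ?_)
  exact (hasFDerivAt_secondDiff hf y x).const_smul _

end Lap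


/-! ### Hölder classes of Banach-valued functions -/

section Holder

/-- `f ∈ C^{k,α}`, where `f` and its derivatives up to order `k`, and the `α`-Hölder seminorm of the
`k`-th derivative, are bounded by `M`. -/
def HolderBound {E : Type u} [NormedAddCommGroup E] [NormedSpace ℝ E] (α M : ℝ) :
    ℕ → ∀ {F : Type u} [NormedAddCommGroup F] [NormedSpace ℝ F], (E → F) → Prop
  | 0, _, _, _, f => (∀ x, ‖f x‖ ≤ M) ∧ ∀ x y, ‖f x - f y‖ ≤ M * ‖x - y‖ ^ α
  | k + 1, _, _, _, f => (Differentiable ℝ f ∧ ∀ x, ‖f x‖ ≤ M) ∧ HolderBound α M k (fderiv ℝ f)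

section Normed

variable {E : Type u} [NormedAddCommGroup E] [NormedSpace ℝ E]
  {F G : Type u} [NormedAddCommGroup F] [NormedSpace ℝ F] [NormedAddCommGroup G] [NormedSpace ℝ G]
  {α M N : ℝ} {k : ℕ} {f g : E → F}

lemma HolderBound.norm_le (h : HolderBound α M k f) (x : E) : ‖f x‖ ≤ M := by
  cases k with
  | zero => exact h.1 x
  | succ k => exact h.1.2 x

lemma HolderBound.nonneg (h : HolderBound α M k f) : 0 ≤ M :=
  (norm_nonneg _).trans (h.norm_le 0)

lemma HolderBound.mono (hMN : M ≤ N) (h : HolderBound α M k f) : HolderBound α N k f := by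
  induction k generalizing F with
  | zero =>
    exact ⟨fun x => (h.1 x).trans hMN, fun x y => (h.2 x y).trans (by gcongr)⟩
  | succ k ih => exact ⟨⟨h.1.1, fun x => (h.1.2 x).trans hMN⟩, ih h.2⟩

/-- Differentiating replaces `L` by composition with `L`, whose norm is at most `‖L‖`, so the
constant does not grow with `k`. -/
lemma HolderBound.clm_comp (L : F →L[ℝ] G) (h : HolderBound α M k f) :
    HolderBound α (‖L‖ * M) k (fun x => L (f x)) := by
  induction k generalizing F G with
  | zero =>
    refine ⟨fun x => (L.le_opNorm _).trans (by gcongr; exact h.1 x), fun x y => ?_⟩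
    rw [← map_sub, mul_assoc]
    exact (L.le_opNorm _).trans (by gcongr; exact h.2 x y)
  | succ k ih =>
    refine ⟨⟨L.differentiable.comp h.1.1,
      fun x => (L.le_opNorm _).trans (by gcongr; exact h.1.2 x)⟩, ?_⟩
    have hd : fderiv ℝ (fun x => L (f x))
        = fun x => ContinuousLinearMap.compL ℝ E F G L (fderiv ℝ f x) := by
      ext1 x
      exact (L.hasFDerivAt.comp x (h.1.1 x).hasFDerivAt).fderiv
    rw [hd]
    refine (ih (ContinuousLinearMap.compL ℝ E F G L) h.2).mono ?_
    have := h.nonneg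
    gcongr
    refine ContinuousLinearMap.opNorm_le_bound _ (norm_nonneg _) fun A => ?_
    exact ContinuousLinearMap.opNorm_comp_le L A

lemma HolderBound.add (hf : HolderBound α M k f) (hg : HolderBound α N k g) :
    HolderBound α (M + N) k (fun x => f x + g x) := by
  induction k generalizing F with
  | zero =>
    refine ⟨fun x => (norm_add_le _ _).trans (add_le_add (hf.1 x) (hg.1 x)), fun x y => ?_⟩
    rw [add_sub_add_comm, add_mul]
    exact (norm_add_le _ _).trans (add_le_add (hf.2 x y) (hg.2 x y))
  | succ k ih =>
    refine ⟨⟨hf.1.1.add hg.1.1,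
      fun x => (norm_add_le _ _).trans (add_le_add (hf.1.2 x) (hg.1.2 x))⟩, ?_⟩
    have hd : fderiv ℝ (fun x => f x + g x) = fun x => fderiv ℝ f x + fderiv ℝ g x := by
      ext1 x
      exact ((hf.1.1 x).hasFDerivAt.add (hg.1.1 x).hasFDerivAt).fderiv
    rw [hd]
    exact ih hf.2 hg.2

lemma HolderBound.zero (hM : 0 ≤ M) : HolderBound α M k (fun _ : E => (0 : F)) := by
  induction k generalizing F with
  | zero => exact ⟨fun x => by simpa, fun x y => by simp; positivity⟩
  | succ k ih =>
    refine ⟨⟨differentiable_const _, fun x => by simpa⟩, ?_⟩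
    have : fderiv ℝ (fun _ : E => (0 : F)) = fun _ => 0 := by ext1 x; simp
    rw [this]; exact ih

lemma HolderBound.sum {ι : Type*} (s : Finset ι) {f : ι → E → F}
    (h : ∀ i ∈ s, HolderBound α M k (f i)) :
    HolderBound α (s.card * M) k (fun x => ∑ i ∈ s, f i x) := by
  classical
  induction s using Finset.induction_on with
  | empty => simpa using HolderBound.zero le_rfl
  | insert i s hi ih =>
    have h1 := (h i (Finset.mem_insert_self i s)).add
      (ih fun j hj => h j (Finset.mem_insert_of_mem hj))
    simp only [Finset.sum_insert hi, Finset.card_insert_of_notMem hi]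
    exact h1.mono (by push_cast; linarith)

lemma HolderBound.fderiv_apply (h : HolderBound α M (k + 1) f) (e : E) (he : ‖e‖ ≤ 1) :
    HolderBound α M k (fun x => fderiv ℝ f x e) := by
  refine (h.2.clm_comp (ContinuousLinearMap.apply ℝ F e)).mono ?_
  have h0 := h.nonneg
  have : ‖ContinuousLinearMap.apply ℝ F e‖ ≤ 1 := by
    refine ContinuousLinearMap.opNorm_le_bound _ zero_le_one fun A => ?_
    simp only [ContinuousLinearMap.apply_apply, one_mul]
    exact (A.le_opNorm e).trans (mul_le_of_le_one_right (norm_nonneg _) he)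
  exact mul_le_of_le_one_left h0 this

lemma le_mul_rpow_of_le {K d t : ℝ} (hα0 : 0 < α) (hα1 : α ≤ 1) (hd : 0 ≤ d) (hK : 0 ≤ K)
    (h1 : t ≤ K * d) (h2 : t ≤ K) : t ≤ K * d ^ α := by
  rcases le_total d 1 with h | h
  · have : d ≤ d ^ α := by
      rcases hd.eq_or_lt with rfl | hd
      · positivity
      · simpa using Real.rpow_le_rpow_of_exponent_ge hd h hα1
    exact h1.trans (by gcongr)
  · exact h2.trans (le_mul_of_one_le_right hK (Real.one_le_rpow h hα0.le))

lemma norm_sub_le_of_norm_fderiv_le {K : ℝ} (hf : Differentiable ℝ f)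
    (hK : ∀ x, ‖fderiv ℝ f x‖ ≤ K) (x y : E) : ‖f x - f y‖ ≤ K * ‖x - y‖ :=
  convex_univ.norm_image_sub_le_of_norm_fderiv_le (fun z _ => hf z) (fun z _ => hK z)
    (mem_univ y) (mem_univ x)

/-- The Lipschitz bound serves at distance at most `1` and the sup bound beyond; the latter costs
the factor `2`. -/
lemma HolderBound.of_succ (hα0 : 0 < α) (hα1 : α ≤ 1) (h : HolderBound α M (k + 1) f) :
    HolderBound α (2 * M) k f := by
  have h0 := h.nonneg
  induction k generalizing F with
  | zero =>
    refine ⟨fun x => (h.norm_le x).trans (by linarith), fun x y => ?_⟩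
    refine le_mul_rpow_of_le hα0 hα1 (norm_nonneg _) (by linarith) ?_ ?_
    · refine (norm_sub_le_of_norm_fderiv_le h.1.1 h.2.norm_le x y).trans ?_
      gcongr; linarith
    · exact (norm_sub_le _ _).trans (by linarith [h.norm_le x, h.norm_le y])
  | succ k ih =>
    exact ⟨⟨h.1.1, fun x => (h.norm_le x).trans (by linarith)⟩, ih h.2⟩

lemma HolderBound.continuous (hα0 : 0 < α) (h : HolderBound α M k f) : Continuous f := by
  cases k with
  | zero =>
    rw [continuous_iff_continuousAt]
    intro x
    rw [ContinuousAt, tendsto_iff_norm_sub_tendsto_zero]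
    refine squeeze_zero (fun _ => norm_nonneg _) (fun y => h.2 y x) ?_
    have : Continuous fun y => M * ‖y - x‖ ^ α := by
      refine continuous_const.mul (Continuous.rpow_const (by fun_prop) fun _ => Or.inr hα0.le)
    simpa [Real.zero_rpow hα0.ne'] using this.tendsto x
  | succ k => exact h.1.1.continuous

lemma HolderBound.contDiff (hα0 : 0 < α) (h : HolderBound α M k f) : ContDiff ℝ k f := by
  induction k generalizing F with
  | zero => exact contDiff_zero.2 (h.continuous hα0)
  | succ k ih =>
    exact_mod_cast contDiff_succ_iff_fderiv.2 ⟨h.1.1, by simp, ih h.2⟩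

end Normed

/-! ### Estimates for second differences -/

variable {E : Type u} [NormedAddCommGroup E] [InnerProductSpace ℝ E]
  {F : Type u} [NormedAddCommGroup F] [NormedSpace ℝ F]
  {α M K : ℝ} {f : E → F}

lemma norm_secondDiff_le_of_holder (hf : ∀ x y, ‖f x - f y‖ ≤ K * ‖x - y‖ ^ α) (x y : E) :
    ‖secondDiff y f x‖ ≤ 2 * K * ‖y‖ ^ α := by
  have h1 := hf x (x + y)
  have h2 := hf x (x - y)
  have h : secondDiff y f x = (f x - f (x + y)) + (f x - f (x - y)) := by
    unfold secondDiff; abel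
  rw [sub_add_cancel_left, norm_neg] at h1
  rw [sub_sub_cancel] at h2
  rw [h]
  exact (norm_add_le _ _).trans (by linarith)

/-- Mean value inequality for `t ↦ f (x + t y) + f (x - t y)` on `[0, 1]`: its derivative compares
`fderiv f` at points at most `2‖y‖` apart, and `2 ^ α ≤ 2`. -/
lemma norm_secondDiff_le_of_fderiv_holder (hα0 : 0 ≤ α) (hα1 : α ≤ 1) (hK : 0 ≤ K)
    (hf : Differentiable ℝ f)
    (hf' : ∀ x y, ‖fderiv ℝ f x - fderiv ℝ f y‖ ≤ K * ‖x - y‖ ^ α) (x y : E) :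
    ‖secondDiff y f x‖ ≤ 2 * K * ‖y‖ ^ (1 + α) := by
  have hφ : ∀ t ∈ Icc (0 : ℝ) 1, HasDerivWithinAt (fun t : ℝ => f (x + t • y) + f (x - t • y))
      ((fderiv ℝ f (x + t • y) - fderiv ℝ f (x - t • y)) y) (Icc 0 1) t := by
    intro t _
    have h0 : HasDerivAt (fun t : ℝ => t • y) y t := by
      simpa using (hasDerivAt_id t).smul_const y
    have h1 := (hf (x + t • y)).hasFDerivAt.comp_hasDerivAt t (h0.const_add x)
    have h2 := (hf (x - t • y)).hasFDerivAt.comp_hasDerivAt t (h0.const_sub x)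
    refine ((h1.add h2).congr_deriv ?_).hasDerivWithinAt
    simp [sub_eq_add_neg]
  have hb : ∀ t ∈ Ico (0 : ℝ) 1,
      ‖(fderiv ℝ f (x + t • y) - fderiv ℝ f (x - t • y)) y‖ ≤ 2 * K * ‖y‖ ^ (1 + α) := by
    intro t ht
    have h1 := hf' (x + t • y) (x - t • y)
    have h2 : ‖x + t • y - (x - t • y)‖ ≤ 2 * ‖y‖ := by
      rw [show x + t • y - (x - t • y) = (2 * t) • y by rw [mul_smul, two_smul]; abel, norm_smul,
        Real.norm_of_nonneg (by linarith [ht.1])]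
      nlinarith [norm_nonneg y, ht.2]
    have h3 : ‖x + t • y - (x - t • y)‖ ^ α ≤ 2 * ‖y‖ ^ α := by
      refine (Real.rpow_le_rpow (norm_nonneg _) h2 hα0).trans ?_
      rw [Real.mul_rpow zero_le_two (norm_nonneg _)]
      gcongr
      simpa using Real.rpow_le_rpow_of_exponent_le one_le_two hα1
    refine (ContinuousLinearMap.le_opNorm _ _).trans ?_
    rw [Real.rpow_add_of_nonneg (norm_nonneg y) zero_le_one hα0, Real.rpow_one]
    have h4 : K * ‖x + t • y - (x - t • y)‖ ^ α ≤ K * (2 * ‖y‖ ^ α) := by gcongr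
    nlinarith [norm_nonneg y]
  have := norm_image_sub_le_of_norm_deriv_le_segment_01' hφ hb
  simp only [one_smul, zero_smul, add_zero, sub_zero] at this
  rwa [show secondDiff y f x = -(f (x + y) + f (x - y) - (f x + f x)) by unfold secondDiff; abel,
    norm_neg]

lemma norm_secondDiff_sub_le_of_fderiv (hf : Differentiable ℝ f) {y : E} {L : ℝ}
    (h : ∀ x, ‖secondDiff y (fderiv ℝ f) x‖ ≤ L) (x₁ x₂ : E) :
    ‖secondDiff y f x₁ - secondDiff y f x₂‖ ≤ L * ‖x₁ - x₂‖ := by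
  refine norm_sub_le_of_norm_fderiv_le
    (fun x => (hasFDerivAt_secondDiff hf y x).differentiableAt) (fun x => ?_) x₁ x₂
  rw [(hasFDerivAt_secondDiff hf y x).fderiv]
  exact h x

lemma norm_secondDiff_sub_le (y x₁ x₂ : E) (hf : ∀ x y, ‖f x - f y‖ ≤ K * ‖x - y‖ ^ α) :
    ‖secondDiff y f x₁ - secondDiff y f x₂‖ ≤ 4 * K * ‖x₁ - x₂‖ ^ α := by
  have h1 := hf x₁ x₂
  have h2 := hf (x₁ + y) (x₂ + y)
  have h3 := hf (x₁ - y) (x₂ - y)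
  rw [add_sub_add_right_eq_sub] at h2
  rw [sub_sub_sub_cancel_right] at h3
  have h : secondDiff y f x₁ - secondDiff y f x₂
      = ((f x₁ - f x₂) + (f x₁ - f x₂)) - (f (x₁ + y) - f (x₂ + y))
        - (f (x₁ - y) - f (x₂ - y)) := by
    unfold secondDiff; abel
  rw [h]
  have e1 := norm_sub_le ((f x₁ - f x₂) + (f x₁ - f x₂) - (f (x₁ + y) - f (x₂ + y)))
    (f (x₁ - y) - f (x₂ - y))
  have e2 := norm_sub_le ((f x₁ - f x₂) + (f x₁ - f x₂)) (f (x₁ + y) - f (x₂ + y))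
  have e3 := norm_add_le (f x₁ - f x₂) (f x₁ - f x₂)
  linarith

/-- The bounds on second differences that make `lap s` gain from order `p` to order `p - s`: with
`b < s < a`, they decay like `|y|^a` near the origin and grow like `|y|^b` at infinity. -/
def SecondDiffHolder (a b p M : ℝ) (f : E → F) : Prop :=
  SecondDiffBound a (6 * M) f ∧ ∀ x₁ x₂ y : E, x₁ ≠ x₂ →
    ‖secondDiff y f x₁ - secondDiff y f x₂‖
      ≤ 4 * M * min (‖y‖ ^ a * ‖x₁ - x₂‖ ^ (p - a)) (‖y‖ ^ b * ‖x₁ - x₂‖ ^ (p - b))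

variable [FiniteDimensional ℝ E] [MeasurableSpace E] [BorelSpace E]

/-- Here and for `j = 1`, the `a`-branch bounds the two second differences separately, and the
`b`-branch uses the regularity in `x`. -/
lemma HolderBound.secondDiffHolder_zero (h : HolderBound α M 0 f) :
    SecondDiffHolder α 0 α M f := by
  have h1 := norm_secondDiff_le_of_holder h.2
  have h0 := h.nonneg
  refine ⟨fun x y => (secondDiffBound_of_le h.1 h1 x y).trans_eq (by ring), ?_⟩
  intro x₁ x₂ y hx
  rw [mul_min_of_nonneg _ _ (by positivity)]
  refine le_min ?_ ?_
  · have := norm_sub_le (secondDiff y f x₁) (secondDiff y f x₂)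
    simp only [sub_self, Real.rpow_zero, mul_one]
    linarith [h1 x₁ y, h1 x₂ y]
  · simpa using norm_secondDiff_sub_le y x₁ x₂ h.2

lemma HolderBound.secondDiffHolder_one (hα0 : 0 < α) (hα1 : α ≤ 1) (h : HolderBound α M 1 f) :
    SecondDiffHolder (1 + α) α (1 + α) M f := by
  have h0 := h.nonneg
  have h1 := norm_secondDiff_le_of_fderiv_holder hα0.le hα1 h0 h.1.1 h.2.2
  refine ⟨fun x y => (secondDiffBound_of_le h.norm_le h1 x y).trans_eq (by ring), ?_⟩
  intro x₁ x₂ y hx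
  rw [mul_min_of_nonneg _ _ (by positivity)]
  refine le_min ?_ ?_
  · have := norm_sub_le (secondDiff y f x₁) (secondDiff y f x₂)
    simp only [sub_self, Real.rpow_zero, mul_one]
    linarith [h1 x₁ y, h1 x₂ y]
  · have := norm_secondDiff_sub_le_of_fderiv h.1.1
      (fun x => norm_secondDiff_le_of_holder h.2.2 x y) x₁ x₂
    rw [add_sub_cancel_right, Real.rpow_one]
    refine this.trans ?_
    have : 0 ≤ M * (‖y‖ ^ α * ‖x₁ - x₂‖) := by positivity
    nlinarith

lemma HolderBound.secondDiffHolder_two (hα0 : 0 < α) (hα1 : α ≤ 1) (h : HolderBound α M 2 f) :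
    SecondDiffHolder (1 + 1) (1 + α) (2 + α) M f := by
  have h0 := h.nonneg
  have h1 := norm_secondDiff_le_of_fderiv_holder zero_le_one le_rfl h0 h.1.1 (fun x y => by
    simpa using norm_sub_le_of_norm_fderiv_le h.2.1.1 h.2.2.1 x y)
  refine ⟨fun x y => (secondDiffBound_of_le h.norm_le h1 x y).trans_eq (by ring), ?_⟩
  intro x₁ x₂ y hx
  rw [mul_min_of_nonneg _ _ (by positivity)]
  refine le_min ?_ ?_
  -- The difference of second differences is one second difference of the increment `g`, whose
  -- second derivative is at most `M ‖x₁ - x₂‖ ^ α`.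
  · set g : E → F := fun x => f (x + (x₁ - x₂)) - f x with hg
    have hgd : ∀ {G : Type u} [NormedAddCommGroup G] [NormedSpace ℝ G] {f : E → G},
        Differentiable ℝ f → ∀ x, HasFDerivAt (fun x => f (x + (x₁ - x₂)) - f x)
          (fderiv ℝ f (x + (x₁ - x₂)) - fderiv ℝ f x) x := by
      intro G _ _ f hf x
      refine HasFDerivAt.sub ?_ (hf x).hasFDerivAt
      simpa [Function.comp_def] using
        (hf (x + (x₁ - x₂))).hasFDerivAt.comp x ((hasFDerivAt_id x).add_const (x₁ - x₂))
    have hgf : fderiv ℝ g = fun x => fderiv ℝ f (x + (x₁ - x₂)) - fderiv ℝ f x :=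
      funext fun x => (hgd h.1.1 x).fderiv
    have hlip : ∀ x y, ‖fderiv ℝ g x - fderiv ℝ g y‖
        ≤ (M * ‖x₁ - x₂‖ ^ α) * ‖x - y‖ ^ (1 : ℝ) := by
      intro x z
      rw [Real.rpow_one, hgf]
      refine norm_sub_le_of_norm_fderiv_le (fun x => (hgd h.2.1.1 x).differentiableAt)
        (fun x => ?_) x z
      rw [(hgd h.2.1.1 x).fderiv]
      have := h.2.2.2 (x + (x₁ - x₂)) x
      rwa [add_sub_cancel_left] at this
    have := norm_secondDiff_le_of_fderiv_holder zero_le_one le_rfl (by positivity)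
      (fun x => (hgd h.1.1 x).differentiableAt) hlip x₂ y
    have e : secondDiff y f x₁ - secondDiff y f x₂ = secondDiff y g x₂ := by
      simp only [secondDiff, hg]
      rw [add_sub_cancel, show x₂ + y + (x₁ - x₂) = x₁ + y by abel,
        show x₂ - y + (x₁ - x₂) = x₁ - y by abel]
      abel
    rw [e, show (2 + α - (1 + 1)) = α by ring]
    refine this.trans ?_
    have : 0 ≤ M * (‖x₁ - x₂‖ ^ α * ‖y‖ ^ ((1 : ℝ) + 1)) := by positivity
    nlinarith
  · have h2 := norm_secondDiff_le_of_fderiv_holder hα0.le hα1 h0 h.2.1.1 h.2.2.2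
    have := norm_secondDiff_sub_le_of_fderiv h.1.1 (fun x => h2 x y) x₁ x₂
    rw [show 2 + α - (1 + α) = 1 by ring, Real.rpow_one]
    refine this.trans ?_
    have : 0 ≤ M * (‖y‖ ^ (1 + α) * ‖x₁ - x₂‖) := by positivity
    nlinarith

/-! ### Hölder estimates for the singular integral -/

variable (E) in
-- Since `s < 2` and `α > 0`, only `j = 0, 1, 2` occur. For `j = 2` the exponent `a` stops at `2`,
-- which still exceeds `s`.
lemma exists_secondDiffHolder {s : ℝ} (hs0 : 0 < s) (hs2 : s < 2) (hα0 : 0 < α) (hα1 : α ≤ 1)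
    {j : ℕ} (h0 : 0 < j + α - s) (h1 : j + α - s < 1) :
    ∃ a b : ℝ, s < a ∧ b < s ∧ ∀ (F : Type u) [NormedAddCommGroup F] [NormedSpace ℝ F]
      (M : ℝ) (f : E → F), HolderBound α M j f → SecondDiffHolder a b (j + α) M f := by
  have hj : j ≤ 2 := by
    have : (j : ℝ) < 3 := by linarith
    have : j < 3 := by exact_mod_cast this
    omega
  interval_cases j
  · exact ⟨α, 0, by simpa using h0, hs0, fun F _ _ M f h => by
      simpa using h.secondDiffHolder_zero⟩
  · push_cast at *
    exact ⟨1 + α, α, by linarith, by linarith, fun F _ _ M f h => h.secondDiffHolder_one hα0 hα1⟩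
  · push_cast at *
    exact ⟨1 + 1, 1 + α, by linarith, by linarith, fun F _ _ M f h =>
      h.secondDiffHolder_two hα0 hα1⟩

variable (E) in
-- The exponent `a` is fixed before `l`, since the induction step needs the same one for `f` and for
-- its derivative.
theorem exists_holderBound_lap {s : ℝ} (hs0 : 0 < s) (hs2 : s < 2) (hα0 : 0 < α) (hα1 : α ≤ 1)
    {j : ℕ} (h0 : 0 < j + α - s) (h1 : j + α - s < 1) :
    ∃ a, s < a ∧ ∀ l : ℕ, ∃ C : ℝ, 0 ≤ C ∧ ∀ (F : Type u) [NormedAddCommGroup F] [NormedSpace ℝ F]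
      (M : ℝ) (f : E → F), HolderBound α M (j + l) f →
        SecondDiffBound a (C * M) f ∧ HolderBound (j + α - s) (C * M) l (lap s f) := by
  obtain ⟨a, b, ha, hb, H⟩ := exists_secondDiffHolder E hs0 hs2 hα0 hα1 h0 h1
  refine ⟨a, ha, fun l => ?_⟩
  set I₀ := ∫ y : E, min (‖y‖ ^ a) 1 * rieszKernel s y
  have hI₀ : 0 ≤ I₀ := integral_nonneg fun y => mul_nonneg (by positivity) (rieszKernel_nonneg s y)
  set I₁ := ∫ y : E, min (‖y‖ ^ a) (‖y‖ ^ b) * rieszKernel s y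
  have hI₁ : 0 ≤ I₁ := integral_nonneg fun y => mul_nonneg (by positivity) (rieszKernel_nonneg s y)
  induction l with
  | zero =>
    -- The three terms pay for the second differences, the sup norm and the Hölder seminorm
    -- respectively.
    refine ⟨6 + 6 * I₀ + 4 * I₁, by positivity, fun F _ _ M f hf => ?_⟩
    have hM := hf.nonneg
    obtain ⟨hA, hB⟩ := H F M f hf
    refine ⟨fun x y => (hA x y).trans ?_, fun x => ?_, fun x₁ x₂ => ?_⟩
    · gcongr
      nlinarith [mul_nonneg hI₀ hM, mul_nonneg hI₁ hM]
    · refine (norm_lap_le hs0 ha hA x).trans ?_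
      change 6 * M * I₀ ≤ _
      nlinarith [mul_nonneg hI₀ hM, mul_nonneg hI₁ hM]
    · rcases eq_or_ne x₁ x₂ with rfl | hx
      · simp only [sub_self, norm_zero]; positivity
      · refine (norm_lap_sub_le hs0 hb ha (hf.continuous hα0) hA hx
          (fun y => hB x₁ x₂ y hx)).trans ?_
        refine mul_le_mul_of_nonneg_right ?_ (by positivity)
        change 4 * M * I₁ ≤ _
        nlinarith [mul_nonneg hI₀ hM, mul_nonneg hI₁ hM]
  | succ l ih =>
    obtain ⟨C, hC0, hC⟩ := ih
    refine ⟨2 * C, by positivity, fun F _ _ M f hf => ?_⟩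
    have hM := hf.nonneg
    obtain ⟨hA, hB⟩ := hC F (2 * M) f (HolderBound.of_succ hα0 hα1 (k := j + l) hf)
    obtain ⟨hA', hB'⟩ := hC _ M (fderiv ℝ f) (hf : HolderBound α M (j + l + 1) f).2
    have hd := hasFDerivAt_lap hs0 ha hf.1.1 (hf.2.continuous hα0) hA hA'
    have hle : C * (2 * M) ≤ 2 * C * M := by linarith
    refine ⟨fun x y => (hA x y).trans (by gcongr), ⟨fun x => (hd x).differentiableAt,
      fun x => (hB.norm_le x).trans hle⟩, ?_⟩
    have : fderiv ℝ (lap s f) = lap s (fderiv ℝ f) := funext fun x => (hd x).fderiv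
    rw [this]
    exact hB'.mono (by nlinarith [mul_nonneg hC0 hM])

end Holder


/-! ### Functions on the torus as periodic functions on Euclidean space -/

section Lift

variable {n : ℕ}

/-- The covering map `ℝⁿ → 𝕋ⁿ`. -/
noncomputable def toTorus (x : EuclideanSpace ℝ (Fin n)) : Torus n := fun i =>
  (x i : AddCircle (2 * Real.pi))

/-- The periodic function on Euclidean space given by a function on the torus. -/
noncomputable def lift {F : Type*} (v : Torus n → F) (x : EuclideanSpace ℝ (Fin n)) : F :=
  v (toTorus x)

lemma toTorus_add (x y : EuclideanSpace ℝ (Fin n)) : toTorus (x + y) = toTorus x + toTorus y := by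
  ext i; simp [toTorus]

lemma toTorus_sub (x y : EuclideanSpace ℝ (Fin n)) : toTorus (x - y) = toTorus x - toTorus y := by
  ext i; simp [toTorus]

lemma isOpenQuotientMap_toTorus : IsOpenQuotientMap (toTorus (n := n)) := by
  have h1 : IsOpenQuotientMap (fun (x : Fin n → ℝ) (i : Fin n) =>
      (x i : AddCircle (2 * Real.pi))) :=
    IsOpenQuotientMap.piMap fun _ => QuotientAddGroup.isOpenQuotientMap_mk
  exact h1.comp (PiLp.homeomorph 2 (fun _ : Fin n => ℝ)).isOpenQuotientMap

lemma continuous_toTorus : Continuous (toTorus (n := n)) := isOpenQuotientMap_toTorus.continuous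

lemma continuous_lift_iff {F : Type*} [TopologicalSpace F] {v : Torus n → F} :
    Continuous (lift v) ↔ Continuous v :=
  (isOpenQuotientMap_toTorus.isQuotientMap.continuous_iff (g := v)).symm

lemma isCm_iff {F : Type*} [NormedAddCommGroup F] [NormedSpace ℝ F] {m : ℕ∞} {v : Torus n → F} :
    IsCm m v ↔ ContDiff ℝ m (lift v) :=
  ((EuclideanSpace.equiv (Fin n) ℝ).contDiff_comp_iff (f := repetition v)).symm

lemma exists_toTorus_sub_eq (x y : Torus n) :
    ∃ x' y' : EuclideanSpace ℝ (Fin n), toTorus x' = x ∧ toTorus y' = y ∧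
      ‖x' - y'‖ = geodesicDist x y := by
  obtain ⟨y', rfl⟩ := isOpenQuotientMap_toTorus.surjective y
  have h : ∀ i, ∃ t : ℝ, (t : AddCircle (2 * Real.pi)) = x i - toTorus y' i ∧
      |t| = ‖x i - toTorus y' i‖ := by
    intro i
    obtain ⟨t, ht⟩ := QuotientAddGroup.mk_surjective (x i - toTorus y' i)
    -- The representative nearest to zero realizes the arc length.
    refine ⟨t - round ((2 * Real.pi)⁻¹ * t) * (2 * Real.pi), ?_, ?_⟩
    · rw [← ht, AddCircle.coe_sub, sub_eq_self, ← zsmul_eq_mul]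
      exact (AddCircle.coe_eq_zero_iff _).2 ⟨_, rfl⟩
    · rw [← ht]
      exact (AddCircle.norm_eq (p := 2 * Real.pi)).symm
  choose t ht ht' using h
  refine ⟨y' + WithLp.toLp 2 t, y', ?_, rfl, ?_⟩
  · rw [toTorus_add]
    ext i
    simp [toTorus, ht]
  · rw [add_sub_cancel_left, EuclideanSpace.norm_eq, geodesicDist]
    simp [ht']

lemma geodesicDist_toTorus_le (x y : EuclideanSpace ℝ (Fin n)) :
    geodesicDist (toTorus x) (toTorus y) ≤ ‖x - y‖ := by
  rw [EuclideanSpace.norm_eq, geodesicDist]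
  refine Real.sqrt_le_sqrt (Finset.sum_le_sum fun i _ => ?_)
  gcongr
  have : toTorus x i - toTorus y i = ((x i - y i : ℝ) : AddCircle (2 * Real.pi)) := by
    simp [toTorus]
  rw [this]
  simpa using QuotientAddGroup.norm_mk_le_norm (S := AddSubgroup.zmultiples (2 * Real.pi))
    (m := x i - y i)

lemma geodesicDist_nonneg (x y : Torus n) : 0 ≤ geodesicDist x y := Real.sqrt_nonneg _

lemma geodesicDist_pos {x y : Torus n} (h : x ≠ y) : 0 < geodesicDist x y := by
  obtain ⟨x', y', rfl, rfl, hd⟩ := exists_toTorus_sub_eq x y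
  rw [← hd]
  exact norm_pos_iff.2 (sub_ne_zero.2 fun h' => h (by rw [h']))

/-! ### Partial derivatives on the torus -/

lemma lift_partialDeriv {v : Torus n → ℝ} (hv : Differentiable ℝ (lift v)) (i : Fin n) :
    lift (partialDeriv i v)
      = fun x => fderiv ℝ (lift v) x (EuclideanSpace.single i 1) := by
  ext x
  rw [← (hv x).lineDeriv_eq_fderiv]
  unfold lift partialDeriv lineDeriv
  congr 1
  ext t
  simp only [toTorus_add]
  congr 2
  ext j
  by_cases h : j = i
  · subst h; simp [toTorus]
  · simp [toTorus, h]

lemma IsCm.differentiable {m : ℕ} {v : Torus n → ℝ} (hv : IsCm ((m + 1 : ℕ) : ℕ∞) v) :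
    Differentiable ℝ (lift v) :=
  (isCm_iff.1 hv).differentiable (by simp)

lemma IsCm.of_le_nat {m p : ℕ} (h : m ≤ p) {v : Torus n → ℝ} (hv : IsCm (p : ℕ∞) v) :
    IsCm (m : ℕ∞) v :=
  ContDiff.of_le hv (by exact_mod_cast h)

lemma IsCm.partialDeriv {m : ℕ} {v : Torus n → ℝ} (hv : IsCm ((m + 1 : ℕ) : ℕ∞) v) (i : Fin n) :
    IsCm (m : ℕ∞) (partialDeriv i v) := by
  rw [isCm_iff, lift_partialDeriv hv.differentiable]
  exact ((isCm_iff.1 hv).fderiv_right (m := m) (by simp)).clm_apply contDiff_const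

lemma partialDeriv_comm {v : Torus n → ℝ} (hv : IsCm (2 : ℕ) v) (i j : Fin n) :
    partialDeriv i (partialDeriv j v) = partialDeriv j (partialDeriv i v) := by
  have hd := (isCm_iff.1 hv).fderiv_right (m := 1) (by norm_num)
  have key : ∀ i j, ∀ x, lift (partialDeriv i (partialDeriv j v)) x
      = fderiv ℝ (fderiv ℝ (lift v)) x (EuclideanSpace.single i 1) (EuclideanSpace.single j 1) := by
    intro i j x
    rw [lift_partialDeriv (IsCm.differentiable (m := 0) (hv.partialDeriv j)),
      lift_partialDeriv (IsCm.differentiable (m := 1) hv)]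
    have hx : DifferentiableAt ℝ (fderiv ℝ (lift v)) x := hd.differentiable (by simp) x
    beta_reduce
    rw [fderiv_clm_apply hx (differentiableAt_const _)]
    simp
  ext z
  obtain ⟨x, rfl⟩ := isOpenQuotientMap_toTorus.surjective z
  have h1 := key i j x
  have h2 := key j i x
  simp only [lift] at h1 h2
  rw [h1, h2]
  exact ((isCm_iff.1 hv).contDiffAt.isSymmSndFDerivAt (by simp)).eq _ _

lemma IsCm.iterate_partialDeriv {m p : ℕ} {v : Torus n → ℝ} (hv : IsCm ((m + p : ℕ) : ℕ∞) v)
    (i : Fin n) : IsCm (m : ℕ∞) ((FracTorus.partialDeriv i)^[p] v) := by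
  induction p generalizing v with
  | zero => simpa using hv
  | succ p ih => exact ih (IsCm.partialDeriv (m := m + p) hv i)

lemma partialDeriv_iterate_comm {p : ℕ} {v : Torus n → ℝ} (hv : IsCm ((p + 1 : ℕ) : ℕ∞) v)
    (i j : Fin n) :
    partialDeriv i ((partialDeriv j)^[p] v) = (partialDeriv j)^[p] (partialDeriv i v) := by
  induction p generalizing v with
  | zero => rfl
  | succ p ih =>
    rw [Function.iterate_succ_apply, ih (hv.partialDeriv j), Function.iterate_succ_apply,
      partialDeriv_comm (hv.of_le_nat (by omega))]

/-- Iterated partial derivatives in the order given by a list. -/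
noncomputable def listDeriv (L : List (Fin n)) (γ : Fin n → ℕ) (v : Torus n → ℝ) : Torus n → ℝ :=
  L.foldr (fun i f => (partialDeriv i)^[γ i] f) v

lemma listDeriv_cons (i : Fin n) (L : List (Fin n)) (γ : Fin n → ℕ) (v : Torus n → ℝ) :
    listDeriv (i :: L) γ v = (partialDeriv i)^[γ i] (listDeriv L γ v) := rfl

lemma IsCm.listDeriv (L : List (Fin n)) {γ : Fin n → ℕ} {m : ℕ} {v : Torus n → ℝ}
    (hv : IsCm ((m + (L.map γ).sum : ℕ) : ℕ∞) v) : IsCm (m : ℕ∞) (listDeriv L γ v) := by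
  induction L generalizing m with
  | nil => exact hv
  | cons i L ih =>
    rw [listDeriv_cons]
    refine IsCm.iterate_partialDeriv (ih ?_) i
    rwa [List.map_cons, List.sum_cons, ← add_assoc] at hv

lemma partialDeriv_listDeriv (L : List (Fin n)) {γ : Fin n → ℕ} {v : Torus n → ℝ}
    (hv : IsCm (((L.map γ).sum + 1 : ℕ) : ℕ∞) v) (i : Fin n) :
    partialDeriv i (listDeriv L γ v) = listDeriv L γ (partialDeriv i v) := by
  induction L with
  | nil => rfl
  | cons j L ih =>
    rw [List.map_cons, List.sum_cons] at hv
    rw [listDeriv_cons, listDeriv_cons, ← ih (hv.of_le_nat (by omega)),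
      partialDeriv_iterate_comm]
    exact IsCm.listDeriv L (m := γ j + 1) (hv.of_le_nat (by omega))

lemma listDeriv_congr (L : List (Fin n)) {γ γ' : Fin n → ℕ} {v : Torus n → ℝ}
    (h : ∀ i ∈ L, γ i = γ' i) : listDeriv L γ v = listDeriv L γ' v := by
  induction L with
  | nil => rfl
  | cons j L ih =>
    rw [listDeriv_cons, listDeriv_cons, ih fun i hi => h i (List.mem_cons_of_mem j hi),
      h j List.mem_cons_self]

/-- The extra derivative commutes outwards to the slot of `i`; as `L` has no duplicates, no other
slot sees the change of `γ`. -/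
lemma listDeriv_partialDeriv (L : List (Fin n)) (hL : L.Nodup) {γ : Fin n → ℕ} {v : Torus n → ℝ}
    (hv : IsCm (((L.map γ).sum + 1 : ℕ) : ℕ∞) v) {i : Fin n} (hi : i ∈ L) :
    listDeriv L γ (partialDeriv i v) = listDeriv L (γ + Pi.single i 1) v := by
  induction L with
  | nil => simp at hi
  | cons j L ih =>
    rw [List.map_cons, List.sum_cons] at hv
    have hv' : IsCm (((L.map γ).sum + 1 : ℕ) : ℕ∞) v := hv.of_le_nat (by omega)
    rw [List.nodup_cons] at hL
    rw [listDeriv_cons, listDeriv_cons]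
    by_cases hij : i = j
    · subst hij
      rw [← partialDeriv_listDeriv L hv', listDeriv_congr L (γ' := γ + Pi.single i 1)]
      · simp
      · intro k hk
        have : k ≠ i := fun h => hL.1 (h ▸ hk)
        simp [this]
    · rw [ih hL.2 hv' ((List.mem_cons.1 hi).resolve_left hij)]
      simp [Ne.symm hij]

lemma sum_map_finRange (γ : Fin n → ℕ) : ((List.finRange n).map γ).sum = ∑ i, γ i := by
  rw [Fin.sum_univ_def]

lemma multiDeriv_partialDeriv {γ : Fin n → ℕ} {v : Torus n → ℝ}
    (hv : IsCm ((∑ i, γ i + 1 : ℕ) : ℕ∞) v) (i : Fin n) :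
    multiDeriv γ (partialDeriv i v) = multiDeriv (γ + Pi.single i 1) v :=
  listDeriv_partialDeriv (List.finRange n) (List.nodup_finRange n)
    (by rwa [sum_map_finRange]) (List.mem_finRange i)

lemma IsCm.multiDeriv {γ : Fin n → ℕ} {m : ℕ} {v : Torus n → ℝ}
    (hv : IsCm ((m + ∑ i, γ i : ℕ) : ℕ∞) v) : IsCm (m : ℕ∞) (multiDeriv γ v) :=
  IsCm.listDeriv (List.finRange n) (by rwa [sum_map_finRange])

/-! ### Comparison of the Hölder spaces -/

lemma HolderBound.lift_iterate_partialDeriv {α M : ℝ} {m p : ℕ} {w : Torus n → ℝ}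
    (hw : HolderBound α M (m + p) (lift w)) (i : Fin n) :
    HolderBound α M m (lift ((partialDeriv i)^[p] w)) := by
  induction p generalizing w with
  | zero => simpa using hw
  | succ p ih =>
    refine ih ?_
    have hw' : HolderBound α M (m + p + 1) (lift w) := hw
    rw [lift_partialDeriv hw'.1.1]
    exact hw'.fderiv_apply _ (by simp)

lemma HolderBound.lift_listDeriv {α M : ℝ} (L : List (Fin n)) {γ : Fin n → ℕ} {m : ℕ}
    {w : Torus n → ℝ} (hw : HolderBound α M (m + (L.map γ).sum) (lift w)) :
    HolderBound α M m (lift (listDeriv L γ w)) := by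
  induction L generalizing m with
  | nil => exact hw
  | cons i L ih =>
    rw [listDeriv_cons]
    refine HolderBound.lift_iterate_partialDeriv (ih ?_) i
    rwa [List.map_cons, List.sum_cons, ← add_assoc] at hw

lemma HolderBound.lift_multiDeriv {α M : ℝ} {γ : Fin n → ℕ} {m : ℕ}
    {w : Torus n → ℝ} (hw : HolderBound α M (m + ∑ i, γ i) (lift w)) :
    HolderBound α M m (lift (multiDeriv γ w)) :=
  HolderBound.lift_listDeriv (List.finRange n) (by rwa [sum_map_finRange])

lemma HolderBound.supNorm_le {α M : ℝ} {m : ℕ} {w : Torus n → ℝ}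
    (hw : HolderBound α M m (lift w)) : supNorm w ≤ ENNReal.ofReal M := by
  refine iSup_le fun z => ENNReal.ofReal_le_ofReal ?_
  obtain ⟨x, rfl⟩ := isOpenQuotientMap_toTorus.surjective z
  exact hw.norm_le x

lemma HolderBound.holderSeminorm_le {α M : ℝ} {w : Torus n → ℝ}
    (hw : HolderBound α M 0 (lift w)) : holderSeminorm α w ≤ ENNReal.ofReal M := by
  refine iSup_le fun x => iSup_le fun y => iSup_le fun h => ENNReal.ofReal_le_ofReal ?_
  have hd := geodesicDist_pos h
  rw [div_le_iff₀ (by positivity)]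
  obtain ⟨x', y', rfl, rfl, he⟩ := exists_toTorus_sub_eq x y
  rw [← he]
  exact hw.2 x' y'

variable (n) in
/-- The number of terms in the norm of `C^{k,α}(𝕋ⁿ)`. -/
def holderNormCard (k : ℕ) : ℕ :=
  (∑ j ∈ Finset.range (k + 1), (Finset.piAntidiag (Finset.univ : Finset (Fin n)) j).card) +
    (Finset.piAntidiag (Finset.univ : Finset (Fin n)) k).card

lemma HolderBound.memHolderSpace {α M : ℝ} (hα : 0 < α) {k : ℕ} {w : Torus n → ℝ}
    (hw : HolderBound α M k (lift w)) : MemHolderSpace k α w := by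
  refine ⟨isCm_iff.2 (hw.contDiff hα), fun γ hγ =>
    ne_top_of_le_ne_top (ENNReal.ofReal_ne_top (r := M))
    (HolderBound.holderSeminorm_le (HolderBound.lift_multiDeriv (γ := γ) (m := 0) ?_))⟩
  simpa [hγ] using hw

lemma HolderBound.holderNorm_le {α M : ℝ} {k : ℕ} {w : Torus n → ℝ}
    (hw : HolderBound α M k (lift w)) :
    holderNorm k α w ≤ holderNormCard n k * ENNReal.ofReal M := by
  unfold holderNorm holderNormCard
  rw [Nat.cast_add, add_mul, Nat.cast_sum, Finset.sum_mul]
  refine add_le_add (Finset.sum_le_sum fun j hj => ?_) ?_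
  · rw [← nsmul_eq_mul]
    refine Finset.sum_le_card_nsmul _ _ _ fun γ hγ => ?_
    refine HolderBound.supNorm_le (α := α) (m := k - j) (HolderBound.lift_multiDeriv ?_)
    rw [(Finset.mem_piAntidiag.1 hγ).1, Nat.sub_add_cancel (by simpa [Nat.lt_succ_iff] using hj)]
    exact hw
  · rw [← nsmul_eq_mul]
    refine Finset.sum_le_card_nsmul _ _ _ fun γ hγ => ?_
    refine HolderBound.holderSeminorm_le (HolderBound.lift_multiDeriv ?_)
    rw [(Finset.mem_piAntidiag.1 hγ).1, zero_add]
    exact hw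

/-- The Fréchet derivative is `∑ ∂ᵢv dxᵢ` with `‖dxᵢ‖ ≤ 1`, so each order costs a factor `n`. Using
`n + 1` keeps the constant at least `B` when `n = 0`. -/
lemma holderBound_lift_of_multiDeriv {α B : ℝ} (hα : 0 ≤ α) {k : ℕ} {v : Torus n → ℝ}
    (hv : IsCm (k : ℕ∞) v)
    (hsup : ∀ γ : Fin n → ℕ, ∑ i, γ i ≤ k → ∀ z, |multiDeriv γ v z| ≤ B)
    (hhol : ∀ γ : Fin n → ℕ, ∑ i, γ i = k → ∀ y z,
      |multiDeriv γ v y - multiDeriv γ v z| ≤ B * geodesicDist y z ^ α) :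
    HolderBound α ((n + 1) ^ k * B) k (lift v) := by
  have hzero : ∀ v : Torus n → ℝ, multiDeriv 0 v = v := by
    intro v
    have : ∀ L : List (Fin n), listDeriv L 0 v = v := by
      intro L
      induction L with
      | nil => rfl
      | cons i L ih => rw [listDeriv_cons, ih]; rfl
    exact this _
  have hB : 0 ≤ B := (abs_nonneg _).trans (hsup 0 (by simp) 0)
  induction k generalizing v with
  | zero =>
    refine ⟨fun x => ?_, fun x y => ?_⟩
    · have := hsup 0 (by simp) (toTorus x)
      rw [hzero] at this
      rwa [pow_zero, one_mul]
    · have := hhol 0 (by simp) (toTorus x) (toTorus y)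
      rw [hzero] at this
      rw [pow_zero, one_mul]
      refine this.trans ?_
      gcongr
      exacts [geodesicDist_nonneg _ _, geodesicDist_toTorus_le x y]
  | succ k ih =>
    have hd : Differentiable ℝ (lift v) := hv.differentiable
    refine ⟨⟨hd, fun x => ?_⟩, ?_⟩
    · have := hsup 0 (by simp) (toTorus x)
      rw [hzero] at this
      exact this.trans (le_mul_of_one_le_left hB
        (one_le_pow₀ (by linarith [n.cast_nonneg (α := ℝ)])))
    · have hi : ∀ i, HolderBound α ((n + 1) ^ k * B) k (lift (partialDeriv i v)) := by
        intro i
        refine ih (hv.partialDeriv i) (fun γ hγ z => ?_) (fun γ hγ y z => ?_)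
        · rw [multiDeriv_partialDeriv (hv.of_le_nat (by omega))]
          exact hsup _ (by simp [Finset.sum_add_distrib]; omega) z
        · rw [multiDeriv_partialDeriv (hv.of_le_nat (by omega))]
          exact hhol _ (by simp [Finset.sum_add_distrib]; omega) y z
      have hproj : ∀ i : Fin n, ‖ContinuousLinearMap.smulRightL ℝ (EuclideanSpace ℝ (Fin n)) ℝ
          (EuclideanSpace.proj i)‖ ≤ 1 := by
        intro i
        refine ContinuousLinearMap.opNorm_le_bound _ zero_le_one fun c => ?_
        rw [ContinuousLinearMap.smulRightL_apply_apply, ContinuousLinearMap.norm_smulRight_apply,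
          one_mul]
        refine mul_le_of_le_one_left (norm_nonneg _) ?_
        refine ContinuousLinearMap.opNorm_le_bound _ zero_le_one fun x => ?_
        simpa using PiLp.norm_apply_le x i
      have hsum : fderiv ℝ (lift v) = fun x => ∑ i,
          ContinuousLinearMap.smulRightL ℝ (EuclideanSpace ℝ (Fin n)) ℝ (EuclideanSpace.proj i)
            (lift (partialDeriv i v) x) := by
        ext x y
        simp only [lift_partialDeriv hd]
        have hy : y = ∑ i, y i • EuclideanSpace.single i (1 : ℝ) := by
          ext j
          simp [Finset.sum_apply, Pi.single_apply]
        conv_lhs => rw [hy]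
        simp
      rw [hsum]
      have hn : ∀ i ∈ (Finset.univ : Finset (Fin n)), HolderBound α ((n + 1) ^ k * B) k (fun x =>
          ContinuousLinearMap.smulRightL ℝ (EuclideanSpace ℝ (Fin n)) ℝ (EuclideanSpace.proj i)
            (lift (partialDeriv i v) x)) := fun i _ =>
        ((hi i).clm_comp _).mono (mul_le_of_le_one_left (by positivity) (hproj i))
      refine (HolderBound.sum Finset.univ hn).mono ?_
      rw [Finset.card_univ, Fintype.card_fin, pow_succ']
      have : 0 ≤ ((n : ℝ) + 1) ^ k * B := by positivity
      nlinarith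

lemma supNorm_ne_top {f : Torus n → ℝ} (hf : Continuous f) : supNorm f ≠ ⊤ := by
  obtain ⟨C, hC⟩ := isCompact_univ.exists_bound_of_continuousOn hf.continuousOn
  exact ne_top_of_le_ne_top (ENNReal.ofReal_ne_top (r := C))
    (iSup_le fun x => ENNReal.ofReal_le_ofReal (hC x (mem_univ x)))

lemma MemHolderSpace.holderNorm_ne_top {α : ℝ} {k : ℕ} {v : Torus n → ℝ}
    (hv : MemHolderSpace k α v) : holderNorm k α v ≠ ⊤ := by
  unfold holderNorm
  refine ENNReal.add_ne_top.2 ⟨?_, ?_⟩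
  · refine (ENNReal.sum_ne_top.2 fun j hj => ENNReal.sum_ne_top.2 fun γ hγ => supNorm_ne_top ?_)
    have : IsCm (0 : ℕ) (multiDeriv γ v) := IsCm.multiDeriv (hv.1.of_le_nat (by
      rw [(Finset.mem_piAntidiag.1 hγ).1]; simpa [Nat.lt_succ_iff] using hj))
    exact continuous_lift_iff.1 (isCm_iff.1 this).continuous
  · exact ENNReal.sum_ne_top.2 fun γ hγ => hv.2 γ (Finset.mem_piAntidiag.1 hγ).1

theorem MemHolderSpace.holderBound {α : ℝ} (hα : 0 ≤ α) {k : ℕ} {v : Torus n → ℝ}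
    (hv : MemHolderSpace k α v) :
    HolderBound α ((n + 1) ^ k * (holderNorm k α v).toReal) k (lift v) := by
  have hmem : ∀ γ : Fin n → ℕ, γ ∈ Finset.piAntidiag Finset.univ (∑ i, γ i) := fun γ =>
    Finset.mem_piAntidiag.2 ⟨rfl, fun _ _ => Finset.mem_univ _⟩
  refine holderBound_lift_of_multiDeriv hα hv.1 (fun γ hγ z => ?_) (fun γ hγ y z => ?_)
  · rw [← ENNReal.ofReal_le_iff_le_toReal hv.holderNorm_ne_top]
    refine le_trans ?_ (le_add_right (Finset.single_le_sum (fun _ _ => zero_le)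
      (Finset.mem_range.2 (Nat.lt_succ_of_le hγ))))
    exact (le_iSup (fun x => ENNReal.ofReal |multiDeriv γ v x|) z).trans
      (Finset.single_le_sum (f := fun γ => supNorm (multiDeriv γ v)) (fun _ _ => zero_le) (hmem γ))
  · rcases eq_or_ne y z with rfl | h
    · simp only [sub_self, abs_zero]
      have := geodesicDist_nonneg y y
      positivity
    · have hd := geodesicDist_pos h
      rw [← div_le_iff₀ (by positivity), ← ENNReal.ofReal_le_iff_le_toReal hv.holderNorm_ne_top]
      refine le_trans ?_ (le_add_left (Finset.single_le_sum
        (f := fun γ => holderSeminorm α (multiDeriv γ v)) (fun _ _ => zero_le) (hγ ▸ hmem γ)))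
      exact le_iSup_of_le y (le_iSup_of_le z (le_iSup_of_le h le_rfl))

end Lift


/-! ### The Fourier symbol of the singular integral -/

section Symbol

variable {E : Type u} [NormedAddCommGroup E] [InnerProductSpace ℝ E]
  [FiniteDimensional ℝ E] [MeasurableSpace E] [BorelSpace E]

/-- The Fourier symbol of `lap s`. -/
noncomputable def lapSymbol (s : ℝ) (ξ : E) : ℝ :=
  ∫ y : E, (2 - 2 * Real.cos (inner ℝ ξ y)) * rieszKernel s y

lemma integrable_lapSymbol {s : ℝ} (hs0 : 0 < s) (hs2 : s < 2) (ξ : E) :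
    Integrable (fun y : E => (2 - 2 * Real.cos (inner ℝ ξ y)) * rieszKernel s y) := by
  refine ((integrable_min_one_mul_rieszKernel (E := E) hs0 hs2).const_mul (‖ξ‖ ^ 2 + 4)).mono' ?_
    (Eventually.of_forall fun y => ?_)
  · refine (Continuous.measurable ?_).mul (measurable_rieszKernel s) |>.aestronglyMeasurable
    fun_prop
  · have hK := rieszKernel_nonneg s y
    have h1 := Real.cos_le_one (inner ℝ ξ y)
    rw [Real.norm_of_nonneg (mul_nonneg (by linarith) hK), ← mul_assoc]
    refine mul_le_mul_of_nonneg_right ?_ hK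
    rw [Real.rpow_two]
    have h2 := Real.neg_one_le_cos (inner ℝ ξ y)
    have h3 := Real.one_sub_sq_div_two_le_cos (x := inner ℝ ξ y)
    have h4 : (inner ℝ ξ y) ^ 2 ≤ ‖ξ‖ ^ 2 * ‖y‖ ^ 2 := by
      rw [← mul_pow, ← sq_abs]
      exact pow_le_pow_left₀ (abs_nonneg _) (abs_real_inner_le_norm ξ y) 2
    rcases le_total (‖y‖ ^ 2) 1 with h | h
    · rw [min_eq_left h]; nlinarith [sq_nonneg ‖y‖]
    · rw [min_eq_right h]; nlinarith [sq_nonneg ‖ξ‖]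

/-- The integrand is nonnegative, and positive on the nonempty open slab `0 < ⟨ξ, y⟩ < 1`. -/
lemma lapSymbol_pos {s : ℝ} (hs0 : 0 < s) (hs2 : s < 2) {ξ : E} (hξ : ξ ≠ 0) :
    0 < lapSymbol s ξ := by
  have h0 : 0 ≤ fun y : E => (2 - 2 * Real.cos (inner ℝ ξ y)) * rieszKernel s y := fun y =>
    mul_nonneg (by linarith [Real.cos_le_one (inner ℝ ξ y)]) (rieszKernel_nonneg s y)
  refine (integral_pos_iff_support_of_nonneg h0 (integrable_lapSymbol hs0 hs2 ξ)).2 ?_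
  have hU : IsOpen {y : E | 0 < inner ℝ ξ y ∧ inner ℝ ξ y < 1} :=
    isOpen_Ioo.preimage (f := fun y : E => inner ℝ ξ y) (by fun_prop)
  have hξ' : 0 < ‖ξ‖ := norm_pos_iff.2 hξ
  have hne : {y : E | 0 < inner ℝ ξ y ∧ inner ℝ ξ y < 1}.Nonempty := by
    refine ⟨(1 / (2 * ‖ξ‖ ^ 2)) • ξ, ?_⟩
    have : inner ℝ ξ ((1 / (2 * ‖ξ‖ ^ 2)) • ξ) = 1 / 2 := by
      rw [inner_smul_right, real_inner_self_eq_norm_sq]; field_simp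
    rw [mem_ofPred_eq, this]; norm_num
  refine (hU.measure_pos volume hne).trans_le (measure_mono fun y hy => ?_)
  have hy0 : y ≠ 0 := by rintro rfl; simp at hy
  have hc : Real.cos (inner ℝ ξ y) < 1 := by
    simpa using Real.cos_lt_cos_of_nonneg_of_le_pi le_rfl
      (by linarith [hy.2, Real.pi_gt_three]) hy.1
  have hK : 0 < rieszKernel s y := Real.rpow_pos_of_pos (norm_pos_iff.2 hy0) _
  exact (mul_pos (by linarith) hK).ne'

/-- The reflection that exchanges `ξ` and `η` preserves both the kernel and the volume. -/
lemma lapSymbol_eq_of_norm_eq (s : ℝ) {ξ η : E} (h : ‖ξ‖ = ‖η‖) :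
    lapSymbol s ξ = lapSymbol s η := by
  set R := (ℝ ∙ (ξ - η))ᗮ.reflection
  have hR : R ξ = η := Submodule.reflection_sub h
  have hmp := R.measurePreserving.integral_comp R.toHomeomorph.measurableEmbedding
    (fun y : E => (2 - 2 * Real.cos (inner ℝ η y)) * rieszKernel s y)
  unfold lapSymbol
  rw [← hmp]
  refine integral_congr_ae (Eventually.of_forall fun y => ?_)
  simp only [rieszKernel, LinearIsometryEquiv.norm_map]
  rw [← hR, LinearIsometryEquiv.inner_map_map]

lemma lapSymbol_smul {s d : ℝ} (hd : 0 < d) (ξ : E) :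
    lapSymbol s (d • ξ) = d ^ s * lapSymbol s ξ := by
  have := integral_smul_rieszKernel (E := E) (inv_pos.2 hd) s
    (fun y => 2 - 2 * Real.cos (inner ℝ ξ y))
  rw [inv_inv, Real.inv_rpow hd.le, ← Real.rpow_neg hd.le, neg_neg] at this
  unfold lapSymbol
  rw [← this]
  simp only [inner_smul_left, inner_smul_right, RCLike.conj_to_real]

variable (E) in
lemma exists_lapSymbol_eq {s : ℝ} (hs0 : 0 < s) (hs2 : s < 2) :
    ∃ κ : ℝ, κ ≠ 0 ∧ ∀ ξ : E, lapSymbol s ξ = κ * ‖ξ‖ ^ s := by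
  have hz : lapSymbol s (0 : E) = 0 := by simp [lapSymbol]
  rcases subsingleton_or_nontrivial E with h | h
  · refine ⟨1, one_ne_zero, fun ξ => ?_⟩
    rw [Subsingleton.elim ξ 0, hz, norm_zero, Real.zero_rpow hs0.ne', mul_zero]
  · obtain ⟨e, he⟩ := exists_norm_eq E zero_le_one
    have he0 : e ≠ 0 := by rintro rfl; simp at he
    refine ⟨lapSymbol s e, (lapSymbol_pos hs0 hs2 he0).ne', fun ξ => ?_⟩
    rcases eq_or_ne ξ 0 with rfl | hξ
    · rw [hz, norm_zero, Real.zero_rpow hs0.ne', mul_zero]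
    · rw [lapSymbol_eq_of_norm_eq s (η := ‖ξ‖ • e) (by rw [norm_smul, he]; simp),
        lapSymbol_smul (norm_pos_iff.2 hξ), mul_comm]

end Symbol

/-! ### The singular integral on the torus -/

section TorusLap

variable {n : ℕ} {F : Type} [NormedAddCommGroup F] [NormedSpace ℝ F]

/-- The second difference of a function on the torus. -/
noncomputable def torusDiff (y : EuclideanSpace ℝ (Fin n)) (f : Torus n → F) (z : Torus n) : F :=
  f z + f z - f (z + toTorus y) - f (z - toTorus y)

/-- The singular integral `lap` on the torus. -/
noncomputable def torusLap (s : ℝ) (f : Torus n → F) (z : Torus n) : F :=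
  ∫ y : EuclideanSpace ℝ (Fin n), rieszKernel s y • torusDiff y f z

lemma secondDiff_lift (y : EuclideanSpace ℝ (Fin n)) (f : Torus n → F)
    (x : EuclideanSpace ℝ (Fin n)) : secondDiff y (lift f) x = torusDiff y f (toTorus x) := by
  simp only [secondDiff, torusDiff, lift, toTorus_add, toTorus_sub]

lemma lift_torusLap (s : ℝ) (f : Torus n → F) : lift (torusLap s f) = lap s (lift f) := by
  ext x
  simp only [lap, secondDiff_lift]
  rfl

lemma SecondDiffBound.norm_torusDiff_le {a A : ℝ} {f : Torus n → F}
    (h : SecondDiffBound a A (lift f)) (y : EuclideanSpace ℝ (Fin n)) (z : Torus n) :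
    ‖torusDiff y f z‖ ≤ A * min (‖y‖ ^ a) 1 := by
  obtain ⟨x, rfl⟩ := isOpenQuotientMap_toTorus.surjective z
  rw [← secondDiff_lift]
  exact h x y

lemma integrable_prod_mul_torusDiff {s a A : ℝ} (hs : 0 < s) (ha : s < a) {f g : Torus n → ℂ}
    (hf : Continuous f) (hg : Continuous g) (hgA : SecondDiffBound a A (lift g)) :
    Integrable (fun p : Torus n × EuclideanSpace ℝ (Fin n) =>
      f p.1 * (rieszKernel s p.2 • torusDiff p.2 g p.1)) (volume.prod volume) := by
  obtain ⟨B, hB⟩ := isCompact_univ.exists_bound_of_continuousOn hf.continuousOn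
  have hI := ((integrable_min_one_mul_rieszKernel (E := EuclideanSpace ℝ (Fin n)) hs ha).const_mul
    (B * A)).comp_snd (volume : Measure (Torus n))
  refine hI.mono' ?_ (Eventually.of_forall fun p => ?_)
  · refine Continuous.aestronglyMeasurable (by fun_prop) |>.mul ?_
    refine ((measurable_rieszKernel s).comp measurable_snd).aestronglyMeasurable.smul ?_
    refine Continuous.aestronglyMeasurable ?_
    have := continuous_toTorus (n := n)
    unfold torusDiff
    fun_prop
  · have hK := rieszKernel_nonneg s p.2
    have h1 := hB p.1 (mem_univ _)
    have h2 := hgA.norm_torusDiff_le p.2 p.1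
    rw [norm_mul, norm_smul, Real.norm_of_nonneg hK]
    calc ‖f p.1‖ * (rieszKernel s p.2 * ‖torusDiff p.2 g p.1‖)
        ≤ B * (rieszKernel s p.2 * (A * min (‖p.2‖ ^ a) 1)) := by
          gcongr
          exact (norm_nonneg _).trans h1
      _ = B * A * (min (‖p.2‖ ^ a) 1 * rieszKernel s p.2) := by ring

lemma integral_mul_torusDiff {f g : Torus n → ℂ} (hf : Continuous f) (hg : Continuous g)
    (y : EuclideanSpace ℝ (Fin n)) :
    ∫ z, f z * torusDiff y g z = ∫ z, torusDiff y f z * g z := by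
  have hi : ∀ {h : Torus n → ℂ}, Continuous h → Integrable h := fun hh => by
    simpa using hh.continuousOn.integrableOn_compact (μ := volume) isCompact_univ
  have e1 : ∫ z, f z * g (z + toTorus y) = ∫ z, f (z - toTorus y) * g z := by
    rw [← integral_add_right_eq_self (fun z => f (z - toTorus y) * g z) (toTorus y)]
    simp
  have e2 : ∫ z, f z * g (z - toTorus y) = ∫ z, f (z + toTorus y) * g z := by
    rw [← integral_sub_right_eq_self (fun z => f (z + toTorus y) * g z) (toTorus y)]
    simp
  unfold torusDiff
  simp only [mul_sub, sub_mul, mul_add, add_mul]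
  rw [integral_sub (hi (by fun_prop)) (hi (by fun_prop)),
    integral_sub (hi (by fun_prop)) (hi (by fun_prop)),
    integral_sub (hi (by fun_prop)) (hi (by fun_prop)),
    integral_sub (hi (by fun_prop)) (hi (by fun_prop)), e1, e2]
  ring

/-- Fubini reduces the symmetry to a fixed `y`, where it is translation invariance. The exponents
differ because one factor will be smooth and the other only Hölder. -/
lemma integral_mul_torusLap {s a b A B : ℝ} (hs : 0 < s) (ha : s < a) (hb : s < b)
    {f g : Torus n → ℂ} (hf : Continuous f) (hg : Continuous g)
    (hfA : SecondDiffBound a A (lift f)) (hgB : SecondDiffBound b B (lift g)) :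
    ∫ z, f z * torusLap s g z = ∫ z, torusLap s f z * g z := by
  have h1 := integral_integral_swap
    (f := fun z (y : EuclideanSpace ℝ (Fin n)) => f z * (rieszKernel s y • torusDiff y g z))
    (integrable_prod_mul_torusDiff hs hb hf hg hgB)
  have h2 := integral_integral_swap
    (f := fun z (y : EuclideanSpace ℝ (Fin n)) => g z * (rieszKernel s y • torusDiff y f z))
    (integrable_prod_mul_torusDiff hs ha hg hf hfA)
  simp only [integral_const_mul] at h1 h2
  simp only [mul_smul_comm, integral_smul] at h1 h2
  simp only [mul_comm _ (g _)]
  refine h1.trans (Eq.trans ?_ h2.symm)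
  refine integral_congr_ae (Eventually.of_forall fun y => ?_)
  simp only [integral_mul_torusDiff hf hg, mul_comm (g _)]

/-! ### Smooth functions on the torus -/

/-- The derivative of a periodic function is periodic. Keeping it on the compact torus makes all
derivatives bounded. -/
lemma exists_lift_eq_fderiv {φ : Torus n → F} (hφ : IsCm ⊤ φ) :
    ∃ ψ : Torus n → EuclideanSpace ℝ (Fin n) →L[ℝ] F,
      IsCm ⊤ ψ ∧ lift ψ = fderiv ℝ (lift φ) := by
  have hper : ∀ x y : EuclideanSpace ℝ (Fin n), toTorus x = toTorus y →
      fderiv ℝ (lift φ) x = fderiv ℝ (lift φ) y := by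
    intro x y h
    have : (fun w => lift φ (x + w)) = fun w => lift φ (y + w) := by
      ext w; simp only [lift, toTorus_add, h]
    have := congrArg (fun f => fderiv ℝ f 0) this
    simpa only [fderiv_comp_add_left, add_zero] using this
  have h : lift (fun z => fderiv ℝ (lift φ)
      (Function.surjInv isOpenQuotientMap_toTorus.surjective z)) = fderiv ℝ (lift φ) := by
    ext1 x
    exact hper _ _ (Function.surjInv_eq isOpenQuotientMap_toTorus.surjective _)
  refine ⟨_, ?_, h⟩
  rw [isCm_iff, h]
  exact (isCm_iff.1 hφ).fderiv_right (m := (⊤ : ℕ∞)) (by simp)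

lemma IsCm.continuous {m : ℕ∞} {φ : Torus n → F} (hφ : IsCm m φ) : Continuous φ :=
  continuous_lift_iff.1 (isCm_iff.1 hφ).continuous

lemma exists_norm_lift_le {φ : Torus n → F} (hφ : Continuous φ) :
    ∃ M, ∀ x, ‖lift φ x‖ ≤ M := by
  obtain ⟨M, hM⟩ := isCompact_univ.exists_bound_of_continuousOn hφ.continuousOn
  exact ⟨M, fun x => hM _ (mem_univ _)⟩

lemma exists_secondDiffBound_of_smooth {φ : Torus n → F} (hφ : IsCm ⊤ φ) :
    ∃ A, SecondDiffBound 2 A (lift φ) := by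
  obtain ⟨M, hM⟩ := exists_norm_lift_le hφ.continuous
  obtain ⟨ψ, hψ, hψ'⟩ := exists_lift_eq_fderiv hφ
  obtain ⟨χ, hχ, hχ'⟩ := exists_lift_eq_fderiv hψ
  obtain ⟨N, hN⟩ := exists_norm_lift_le hχ.continuous
  have hN0 : 0 ≤ N := (norm_nonneg _).trans (hN 0)
  have h := norm_secondDiff_le_of_fderiv_holder zero_le_one le_rfl hN0
    ((isCm_iff.1 hφ).differentiable (by simp)) (fun x y => by
      rw [← hψ', Real.rpow_one]
      exact norm_sub_le_of_norm_fderiv_le ((isCm_iff.1 hψ).differentiable (by simp))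
        (fun x => hχ' ▸ hN x) x y)
  rw [one_add_one_eq_two] at h
  exact ⟨_, secondDiffBound_of_le hM h⟩

lemma contDiff_lap_lift {s : ℝ} (hs0 : 0 < s) (hs2 : s < 2) (l : ℕ) {φ : Torus n → F}
    (hφ : IsCm ⊤ φ) : ContDiff ℝ l (lap s (lift φ)) := by
  have hd : ∀ {G : Type} [NormedAddCommGroup G] [NormedSpace ℝ G] {φ : Torus n → G},
      IsCm ⊤ φ → ∀ x, HasFDerivAt (lap s (lift φ)) (lap s (fderiv ℝ (lift φ)) x) x := by
    intro G _ _ φ hφ x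
    obtain ⟨A, hA⟩ := exists_secondDiffBound_of_smooth hφ
    obtain ⟨ψ, hψ, hψ'⟩ := exists_lift_eq_fderiv hφ
    obtain ⟨A', hA'⟩ := exists_secondDiffBound_of_smooth hψ
    rw [hψ'] at hA'
    refine hasFDerivAt_lap hs0 hs2 ((isCm_iff.1 hφ).differentiable (by simp)) ?_ hA hA' x
    rw [← hψ']
    exact (isCm_iff.1 hψ).continuous
  induction l generalizing F with
  | zero =>
    exact contDiff_zero.2 (Differentiable.continuous (𝕜 := ℝ) fun x =>
      (hd hφ x).differentiableAt)
  | succ l ih =>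
    obtain ⟨ψ, hψ, hψ'⟩ := exists_lift_eq_fderiv hφ
    have h : fderiv ℝ (lap s (lift φ)) = lap s (fderiv ℝ (lift φ)) :=
      funext fun x => (hd hφ x).fderiv
    exact_mod_cast contDiff_succ_iff_fderiv.2
      ⟨fun x => (hd hφ x).differentiableAt, by simp, h ▸ hψ' ▸ ih hψ⟩

lemma IsCm.torusLap {s : ℝ} (hs0 : 0 < s) (hs2 : s < 2) {φ : Torus n → F} (hφ : IsCm ⊤ φ) :
    IsCm ⊤ (torusLap s φ) := by
  rw [isCm_iff, lift_torusLap]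
  exact contDiff_infty.2 fun l => contDiff_lap_lift hs0 hs2 l hφ

/-! ### Characters -/

lemma character_toTorus (k : Fin n → ℤ) (x : EuclideanSpace ℝ (Fin n)) :
    character k (toTorus x)
      = Complex.exp ((inner ℝ (WithLp.toLp 2 fun i => (k i : ℝ)) x : ℝ) * Complex.I) := by
  unfold character toTorus
  simp only [fourier_coe_apply]
  rw [← Complex.exp_sum, PiLp.inner_apply, Complex.ofReal_sum, Finset.sum_mul]
  congr 1
  refine Finset.sum_congr rfl fun i _ => ?_
  have : (Real.pi : ℂ) ≠ 0 := by exact_mod_cast Real.pi_ne_zero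
  simp
  field_simp

lemma isCm_character (k : Fin n → ℤ) : IsCm ⊤ (character k) := by
  rw [isCm_iff]
  have : lift (character k) = fun x =>
      Complex.exp ((inner ℝ (WithLp.toLp 2 fun i => (k i : ℝ)) x : ℝ) * Complex.I) :=
    funext fun x => character_toTorus k x
  rw [this]
  refine ContDiff.cexp (ContDiff.mul ?_ contDiff_const)
  exact Complex.ofRealCLM.contDiff.comp (contDiff_const.inner ℝ contDiff_id)

lemma character_add (k : Fin n → ℤ) (z w : Torus n) :
    character k (z + w) = character k z * character k w := by
  unfold character
  rw [← Finset.prod_mul_distrib]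
  refine Finset.prod_congr rfl fun i _ => ?_
  simp [fourier_apply, smul_add, AddCircle.toCircle_add]

lemma norm_character (k : Fin n → ℤ) (z : Torus n) : ‖character k z‖ = 1 := by
  unfold character
  rw [norm_prod]
  exact Finset.prod_eq_one fun i _ => Circle.norm_coe _

lemma norm_toLp_intCast (k : Fin n → ℤ) :
    ‖(WithLp.toLp 2 fun i => (k i : ℝ) : EuclideanSpace ℝ (Fin n))‖ = length k := by
  rw [EuclideanSpace.norm_eq, length]
  simp

lemma torusLap_character {s κ : ℝ}
    (hκ : ∀ ξ : EuclideanSpace ℝ (Fin n), lapSymbol s ξ = κ * ‖ξ‖ ^ s) (k : Fin n → ℤ)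
    (z : Torus n) :
    torusLap s (character k) z = ((κ * length k ^ s : ℝ) : ℂ) * character k z := by
  rw [← norm_toLp_intCast, ← hκ, mul_comm]
  unfold torusLap lapSymbol
  rw [← integral_complex_ofReal, ← integral_const_mul]
  refine integral_congr_ae (Eventually.of_forall fun y => ?_)
  -- Characters are multiplicative, so the two translates contribute `e^{ik·y} + e^{-ik·y} = 2 cos
  -- (k·y)`.
  have h : torusDiff y (character k) z = character k z *
      ((2 - 2 * Real.cos (inner ℝ (WithLp.toLp 2 fun i => (k i : ℝ)) y) : ℝ) : ℂ) := by
    have e : z - toTorus y = z + toTorus (-y) := by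
      rw [sub_eq_add_neg]; congr 1
    unfold torusDiff
    rw [e, character_add, character_add, character_toTorus, character_toTorus, inner_neg_right]
    push_cast
    rw [Complex.cos]
    ring_nf
  simp only [h, Complex.real_smul]
  push_cast
  ring

end TorusLap


section Fourier

variable {n : ℕ}

/-! ### Fourier inversion on the torus -/

variable (n) in
/-- The dilation from the torus of period `1` to the torus of period `2π`. -/
noncomputable def torusDilation : UnitAddTorus (Fin n) →+ Torus n :=
  AddMonoidHom.mk' (fun t i => AddCircle.equivAddCircle 1 (2 * Real.pi) one_ne_zero
    Real.two_pi_pos.ne' (t i)) fun s t => by ext i; simp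

lemma continuous_torusDilation : Continuous (torusDilation n) :=
  continuous_pi fun i => (AddCircle.homeomorphAddCircle 1 (2 * Real.pi) one_ne_zero
    Real.two_pi_pos.ne').continuous.comp (continuous_apply i)

lemma surjective_torusDilation : Function.Surjective (torusDilation n) := fun z =>
  ⟨fun i => (AddCircle.equivAddCircle 1 (2 * Real.pi) one_ne_zero Real.two_pi_pos.ne').symm (z i),
    by ext i; simp [torusDilation]⟩

lemma character_torusDilation (k : Fin n → ℤ) (t : UnitAddTorus (Fin n)) :
    character k (torusDilation n t) = UnitAddTorus.mFourier k t := by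
  unfold character UnitAddTorus.mFourier
  simp only [ContinuousMap.coe_mk]
  refine Finset.prod_congr rfl fun i _ => ?_
  obtain ⟨x, hx⟩ := QuotientAddGroup.mk_surjective (t i)
  have : torusDilation n t i = ((x * (1⁻¹ * (2 * Real.pi)) : ℝ) : AddCircle (2 * Real.pi)) := by
    rw [← AddCircle.equivAddCircle_apply_mk 1 (2 * Real.pi) one_ne_zero Real.two_pi_pos.ne']
    exact congrArg _ hx.symm
  rw [this, ← hx]
  change _ = fourier (k i) (x : AddCircle (1 : ℝ))
  rw [fourier_coe_apply, fourier_coe_apply]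
  have : (Real.pi : ℂ) ≠ 0 := by exact_mod_cast Real.pi_ne_zero
  congr 1
  push_cast
  field_simp

lemma mFourierCoeff_comp_torusDilation {f : Torus n → ℂ} (hf : Continuous f) (k : Fin n → ℤ) :
    UnitAddTorus.mFourierCoeff (f ∘ torusDilation n) k = fourierCoefficient f k := by
  set μ : Measure (UnitAddTorus (Fin n)) := Measure.pi fun _ => AddCircle.haarAddCircle
  have hpos : 0 < (2 * Real.pi) ^ n := by positivity
  -- This factor gives `volume` total mass one; a continuous surjective homomorphism of compact
  -- groups then carries normalized Haar measure to normalized Haar measure.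
  set c : ℝ≥0∞ := ENNReal.ofReal (((2 * Real.pi) ^ n)⁻¹) with hc
  have hc0 : c ≠ 0 := by simpa [hc] using hpos
  have : (c • (volume : Measure (Torus n))).IsAddHaarMeasure :=
    Measure.IsAddHaarMeasure.smul _ hc0 ENNReal.ofReal_ne_top
  have huniv : μ univ = (c • (volume : Measure (Torus n))) univ := by
    have h1 : (volume : Measure (Torus n)) univ = ENNReal.ofReal ((2 * Real.pi) ^ n) := by
      rw [← pi_univ univ, volume_pi_pi]
      simp [AddCircle.measure_univ, ENNReal.ofReal_pow Real.two_pi_pos.le]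
    rw [measure_univ, Measure.smul_apply, h1, hc, smul_eq_mul,
      ← ENNReal.ofReal_mul (by positivity), inv_mul_cancel₀ hpos.ne', ENNReal.ofReal_one]
  have hmp : MeasurePreserving (torusDilation n) μ (c • volume) :=
    AddMonoidHom.measurePreserving continuous_torusDilation surjective_torusDilation huniv
  have hg : Continuous fun z => f z * character (-k) z := hf.mul (isCm_character _).continuous
  have h2 := integral_map (μ := μ) hmp.measurable.aemeasurable hg.aestronglyMeasurable
  rw [hmp.map_eq, integral_smul_measure] at h2
  unfold fourierCoefficient UnitAddTorus.mFourierCoeff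
  have h3 : (c.toReal : ℂ) = ((2 * Real.pi : ℂ) ^ n)⁻¹ := by
    rw [hc, ENNReal.toReal_ofReal (by positivity)]; push_cast; rfl
  rw [← h3, ← Complex.real_smul, h2]
  refine integral_congr_ae (Eventually.of_forall fun t => ?_)
  simp only [Function.comp_apply, smul_eq_mul, character_torusDilation]
  ring

lemma hasSum_fourierCoefficient {f : Torus n → ℂ} (hf : Continuous f)
    (hs : Summable (fourierCoefficient f)) (z : Torus n) :
    HasSum (fun k => fourierCoefficient f k * character k z) (f z) := by
  obtain ⟨t, rfl⟩ := surjective_torusDilation z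
  have hcoe : UnitAddTorus.mFourierCoeff (f ∘ torusDilation n) = fourierCoefficient f :=
    funext (mFourierCoeff_comp_torusDilation hf)
  have := UnitAddTorus.hasSum_mFourier_series_apply_of_summable
    (f := ⟨f ∘ torusDilation n, hf.comp continuous_torusDilation⟩) (by
      simpa only [ContinuousMap.coe_mk, hcoe] using hs) t
  simpa only [ContinuousMap.coe_mk, hcoe, character_torusDilation, Function.comp_apply,
    smul_eq_mul] using this

/-! ### Decay of Fourier coefficients of smooth functions -/

lemma fourierCoefficient_torusLap {s κ : ℝ} (hs0 : 0 < s) (hs2 : s < 2)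
    (hκ : ∀ ξ : EuclideanSpace ℝ (Fin n), lapSymbol s ξ = κ * ‖ξ‖ ^ s) {φ : Torus n → ℂ}
    (hφ : IsCm ⊤ φ) (k : Fin n → ℤ) :
    fourierCoefficient (torusLap s φ) k
      = ((κ * length k ^ s : ℝ) : ℂ) * fourierCoefficient φ k := by
  obtain ⟨A, hA⟩ := exists_secondDiffBound_of_smooth hφ
  obtain ⟨B, hB⟩ := exists_secondDiffBound_of_smooth (isCm_character (-k))
  unfold fourierCoefficient
  rw [← integral_mul_torusLap hs0 hs2 hs2 hφ.continuous (isCm_character (-k)).continuous hA hB,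
    mul_left_comm, ← integral_const_mul ((κ * length k ^ s : ℝ) : ℂ)]
  refine congrArg _ (integral_congr_ae (Eventually.of_forall fun z => ?_))
  have : length (-k) = length k := by simp [length]
  simp only [torusLap_character hκ, this]
  ring

lemma exists_norm_fourierCoefficient_le (f : Torus n → ℂ) :
    ∃ B, ∀ k, ‖fourierCoefficient f k‖ ≤ B := by
  refine ⟨‖((2 * Real.pi : ℂ) ^ n)⁻¹‖ * ∫ z, ‖f z‖, fun k => ?_⟩
  unfold fourierCoefficient
  rw [norm_mul]
  gcongr
  refine (norm_integral_le_integral_norm _).trans_eq ?_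
  simp [norm_character]

/-- `torusLap 1` preserves smoothness and multiplies the coefficients by `κ|k|`, so each application
gains one power of `|k|`. -/
lemma exists_norm_fourierCoefficient_mul_pow_le {φ : Torus n → ℂ} (hφ : IsCm ⊤ φ) (m : ℕ) :
    ∃ B, ∀ k, ‖fourierCoefficient φ k‖ * length k ^ m ≤ B := by
  obtain ⟨κ, hκ0, hκ⟩ := exists_lapSymbol_eq (EuclideanSpace ℝ (Fin n)) one_pos one_lt_two
  induction m generalizing φ with
  | zero => simpa using exists_norm_fourierCoefficient_le φ
  | succ m ih =>
    obtain ⟨B, hB⟩ := ih (hφ.torusLap one_pos one_lt_two)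
    refine ⟨|κ|⁻¹ * B, fun k => ?_⟩
    have hl : 0 ≤ length k := Real.sqrt_nonneg _
    have h := hB k
    rw [fourierCoefficient_torusLap one_pos one_lt_two hκ hφ, Real.rpow_one, norm_mul,
      Complex.norm_real, norm_mul, Real.norm_of_nonneg hl, Real.norm_eq_abs] at h
    have hk : 0 < |κ| := abs_pos.2 hκ0
    rw [le_inv_mul_iff₀ hk, pow_succ]
    calc _ = |κ| * length k * ‖fourierCoefficient φ k‖ * length k ^ m := by ring
      _ ≤ B := h

variable (n) in
lemma summable_inv_length_pow : Summable fun k : Fin n → ℤ => ((length k)⁻¹) ^ (n + 1) := by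
  set b := (EuclideanSpace.basisFun (Fin n) ℝ).toBasis
  set L := Submodule.span ℤ (range b)
  set e := (b.restrictScalars ℤ).equivFun
  have hfin : finrank ℤ L = n := by simpa using finrank_eq_card_basis (b.restrictScalars ℤ)
  have h := ZLattice.summable_norm_pow_inv L (n + 1) (by rw [hfin]; omega)
  have h2 := e.symm.toEquiv.summable_iff.2 h
  refine h2.congr fun k => ?_
  have : (((e.symm k : L) : EuclideanSpace ℝ (Fin n))) = WithLp.toLp 2 fun i => (k i : ℝ) := by
    rw [Basis.equivFun_symm_apply, Submodule.coe_sum]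
    ext j
    simp only [Submodule.coe_smul, Basis.restrictScalars_apply, b]
    simp [Finset.sum_apply, Pi.single_apply]
  rw [← norm_toLp_intCast, ← this]
  rfl

lemma one_le_length {k : Fin n → ℤ} (hk : k ≠ 0) : 1 ≤ length k := by
  obtain ⟨i, hi⟩ := Function.ne_iff.1 hk
  refine Real.one_le_sqrt.2 ?_
  have h1 : (1 : ℝ) ≤ (k i : ℝ) ^ 2 := by
    rw [one_le_sq_iff_one_le_abs]
    exact_mod_cast Int.one_le_abs hi
  exact h1.trans (Finset.single_le_sum (f := fun i => (k i : ℝ) ^ 2) (fun _ _ => sq_nonneg _)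
    (Finset.mem_univ i))

lemma summable_fourierCoefficient {φ : Torus n → ℂ} (hφ : IsCm ⊤ φ) :
    Summable (fourierCoefficient φ) := by
  obtain ⟨B, hB⟩ := exists_norm_fourierCoefficient_mul_pow_le hφ (n + 1)
  refine Summable.of_norm_bounded_eventually ((summable_inv_length_pow n).mul_left B) ?_
  -- At `k = 0` the comparison term is `0`, because `0⁻¹ = 0`, so that index has to be left out.
  filter_upwards [(finite_singleton (0 : Fin n → ℤ)).compl_mem_cofinite] with k hk
  have hl : 0 < length k := zero_lt_one.trans_le (one_le_length hk)
  rw [inv_pow, ← div_eq_mul_inv, le_div_iff₀ (by positivity)]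
  exact hB k

/-- `torusLap (2σ) φ` is again smooth, so it is the sum of its Fourier series, whose coefficients
carry the factor `κ|k|^{2σ}`. -/
lemma fracLaplacian_eq {σ κ : ℝ} (hσ0 : 0 < σ) (hσ1 : σ < 1) (hκ0 : κ ≠ 0)
    (hκ : ∀ ξ : EuclideanSpace ℝ (Fin n), lapSymbol (2 * σ) ξ = κ * ‖ξ‖ ^ (2 * σ))
    {φ : Torus n → ℂ} (hφ : IsCm ⊤ φ) (z : Torus n) :
    fracLaplacian σ φ z = (κ : ℂ)⁻¹ * torusLap (2 * σ) φ z := by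
  have hs0 : 0 < 2 * σ := by linarith
  have hs2 : 2 * σ < 2 := by linarith
  have hsm := hφ.torusLap hs0 hs2
  have h := (hasSum_fourierCoefficient hsm.continuous
    (summable_fourierCoefficient hsm) z).mul_left (κ : ℂ)⁻¹
  unfold fracLaplacian
  rw [← h.tsum_eq]
  refine tsum_congr fun k => ?_
  have : (κ : ℂ) ≠ 0 := by exact_mod_cast hκ0
  rw [fourierCoefficient_torusLap hs0 hs2 hκ hφ]
  push_cast
  field_simp

/-! ### The Hölder estimate -/

lemma torusLap_ofReal (s : ℝ) (v : Torus n → ℝ) (z : Torus n) :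
    torusLap s (fun z => (v z : ℂ)) z = ((torusLap s v z : ℝ) : ℂ) := by
  unfold torusLap
  rw [← integral_complex_ofReal]
  refine integral_congr_ae (Eventually.of_forall fun y => ?_)
  simp [torusDiff]

lemma isFracLaplacian_torusLap {σ κ a A : ℝ} (hσ0 : 0 < σ) (hσ1 : σ < 1) (hκ0 : κ ≠ 0)
    (hκ : ∀ ξ : EuclideanSpace ℝ (Fin n), lapSymbol (2 * σ) ξ = κ * ‖ξ‖ ^ (2 * σ))
    (ha : 2 * σ < a) {v : Torus n → ℝ} (hv : Continuous v) (hA : SecondDiffBound a A (lift v)) :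
    IsFracLaplacian σ v fun z => κ⁻¹ * torusLap (2 * σ) v z := by
  intro φ hφ
  obtain ⟨B, hB⟩ := exists_secondDiffBound_of_smooth hφ
  have hv' : Continuous fun z => (v z : ℂ) := Complex.continuous_ofReal.comp hv
  have hA' : SecondDiffBound a A (lift fun z => (v z : ℂ)) := by
    intro x y
    have : secondDiff y (lift fun z => (v z : ℂ)) x = ((secondDiff y (lift v) x : ℝ) : ℂ) := by
      simp [secondDiff, lift]
    rw [this, Complex.norm_real]
    exact hA x y
  have h := integral_mul_torusLap (by linarith : 0 < 2 * σ) ha (by linarith : 2 * σ < 2) hv'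
    hφ.continuous hA' hB
  unfold fracLaplacianDistribution
  simp only [fracLaplacian_eq hσ0 hσ1 hκ0 hκ hφ, Complex.ofReal_mul, mul_left_comm _ (κ : ℂ)⁻¹,
    Complex.ofReal_inv, mul_assoc, integral_const_mul]
  rw [h]
  simp only [torusLap_ofReal]

theorem fracLaplacianBounded {σ α : ℝ} (hσ0 : 0 < σ) (hσ1 : σ < 1) (hα0 : 0 < α) (hα1 : α ≤ 1)
    {j : ℕ} (l : ℕ) (h0 : 0 < j + α - 2 * σ) (h1 : j + α - 2 * σ < 1) :
    FracLaplacianBounded n σ (j + l) α l (j + α - 2 * σ) := by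
  obtain ⟨κ, hκ0, hκ⟩ := exists_lapSymbol_eq (EuclideanSpace ℝ (Fin n))
    (by linarith : 0 < 2 * σ) (by linarith)
  obtain ⟨a, ha, H⟩ := exists_holderBound_lap (EuclideanSpace ℝ (Fin n))
    (by linarith : 0 < 2 * σ) (by linarith) hα0 hα1 h0 h1
  obtain ⟨C, hC0, hC⟩ := H l
  -- The power of `n + 1` comes from passing from partial to Fréchet derivatives of `v`;
  -- `holderNormCard n l` below counts the terms of the target norm.
  set D : ℝ := |κ⁻¹| * (C * (n + 1) ^ (j + l))
  have hD : 0 ≤ D := by positivity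
  refine ⟨holderNormCard n l * D.toNNReal, fun v hv => ?_⟩
  have hb := hv.holderBound hα0.le
  obtain ⟨hA, hB⟩ := hC ℝ _ (lift v) hb
  have hw : HolderBound (j + α - 2 * σ) (D * (holderNorm (j + l) α v).toReal) l
      (lift fun z => κ⁻¹ * torusLap (2 * σ) v z) := by
    rw [← lift_torusLap] at hB
    refine (hB.clm_comp (κ⁻¹ • ContinuousLinearMap.id ℝ ℝ)).mono ?_
    rw [norm_smul, Real.norm_eq_abs, ContinuousLinearMap.norm_id, mul_one]
    exact le_of_eq (by simp only [D]; ring)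
  refine ⟨_, isFracLaplacian_torusLap hσ0 hσ1 hκ0 hκ ha hv.1.continuous hA,
    hw.memHolderSpace h0, hw.holderNorm_le.trans_eq ?_⟩
  rw [ENNReal.ofReal_mul hD, ENNReal.ofReal_toReal hv.holderNorm_ne_top, ENNReal.coe_mul,
    ENNReal.coe_natCast, mul_assoc]
  rfl

end Fourier
end FracTorus

/-! ### The four cases as choices of `k = j + l` -/

theorem mainTheorem6 (n : ℕ) (σ : ℝ) (hσ0 : 0 < σ) (hσ1 : σ < 1)
    (α : ℝ) (hα0 : 0 < α) (hα1 : α ≤ 1) :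
    (2 * σ < α → FracTorus.FracLaplacianBounded n σ 0 α 0 (α - 2 * σ)) ∧
    (2 * σ < α → FracTorus.FracLaplacianBounded n σ 1 α 1 (α - 2 * σ)) ∧
    (α < 2 * σ → 0 < α - 2 * σ + 1 →
      FracTorus.FracLaplacianBounded n σ 1 α 0 (α - 2 * σ + 1)) ∧
    (∀ (k l : ℕ) (β : ℝ), 0 < (k : ℝ) + α - 2 * σ → (∀ m : ℤ, (k : ℝ) + α - 2 * σ ≠ m) →
      l = ⌊(k : ℝ) + α - 2 * σ⌋₊ → β = (k : ℝ) + α - 2 * σ - l →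
      FracTorus.FracLaplacianBounded n σ k α l β) := by
  have key : ∀ (k j l : ℕ) (β : ℝ), k = j + l → β = j + α - 2 * σ → 0 < β → β < 1 →
      FracTorus.FracLaplacianBounded n σ k α l β := by
    rintro k j l β rfl rfl h0 h1
    exact FracTorus.fracLaplacianBounded hσ0 hσ1 hα0 hα1 l h0 h1
  refine ⟨fun h => key 0 0 0 _ rfl (by simp) (by linarith) (by linarith),
    fun h => key 1 0 1 _ rfl (by simp) (by linarith) (by linarith),
    fun h h' => key 1 1 0 _ rfl (by push_cast; ring) h' (by linarith), ?_⟩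
  intro k l β hpos hint hl hβ
  have h1 : (l : ℝ) ≤ k + α - 2 * σ := hl ▸ Nat.floor_le hpos.le
  have h2 : k + α - 2 * σ < l + 1 := hl ▸ Nat.lt_floor_add_one _
  -- Being a non-integer is what makes `β` strictly positive.
  have hne : k + α - 2 * σ ≠ l := by exact_mod_cast hint l
  -- As `α ≤ 1` and `σ > 0`, the order `k + α - 2σ` is below `k + 1`; hence `j = k - l` is a genuine
  -- subtraction.
  have hlk : l ≤ k := by
    have : (l : ℝ) < k + 1 := by linarith
    exact Nat.lt_succ_iff.1 (by exact_mod_cast this)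
  refine key k (k - l) l β (by omega) (by rw [hβ, Nat.cast_sub hlk]; ring) ?_ (by linarith)
  rw [hβ, sub_pos]
  exact lt_of_le_of_ne h1 hne.symm
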